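/- An $n$-string double wiring diagram consists of $n$ red and $n$ blue piecewise linear strings running from left to right at heights $1,\dots,n$, such that any two strings of the same color cross exactly once, at adjacent heights; it is considered through the sequence, from left to right, of its crossings (color and height). At the left end the red strings are numbered $1,\dots,n$ from top to bottom and the blue strings $1,\dots,n$ from bottom to top. Each chamber with at least one string of each color below it (including the chamber above all strings) is labeled by $(r,b)$, where $r,b\subseteq\{1,\dots,n\}$ are the sets of numbers of the red, respectively blue, strings passing below the chamber; always $|r|=|b|$. Two double wiring diagrams belong to the same commutation class if they have the same set of chamber labels. For an $n\times n$ matrix $M$ and $I,J\subseteq\{1,\dots,n\}$ with $|I|=|J|$, let $\Delta_{I,J}(M)$ be the minor of $M$ with row set $I$ and column set $J$. The chamber minors of a commutation class $w$ are the $\Delta_{r,b}$ for the chamber labels $(r,b)$ of $w$. Theorem. Let $n\le 4$, let $w$ be a commutation class of $n$-string double wiring diagrams, and let $I,J\subseteq\{1,\dots,n\}$ with $|I|=|J|$. Then $\Delta_{I,J}$ is a Laurent polynomial with positive (integer) coefficients in the chamber minors of $w$: there is a Laurent polynomial $f$ in variables indexed by the chamber labels of $w$, all of whose nonzero coefficients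 are positive integers, such that for every field $K$ and every $n\times n$ matrix $M$ over $K$ whose chamber minors $\Delta_{r,b}(M)$ are all nonzero, $\Delta_{I,J}(M)$ is the value of $f$ at the chamber minors of $M$. -/

import Mathlib

/-- The two colours of strings in a double wiring diagram. -/
inductive StringColor where
  | red
  | blue
  deriving DecidableEq

namespace StringColor

/-- The order of the `n` strings of a given colour at the left end of a double wiring diagram,
as a map from positions (counted from the bottom) to labels. Red strings are numbered from top to
bottom, blue strings from bottom to top. (Positions and labels are counted from `0`.) -/
def leftOrder (n : ℕ) : StringColor → Equiv.Perm (Fin n)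
  | red => Fin.revPerm
  | blue => 1

end StringColor

/-- A crossing of two strings of the same colour, the ones in the adjacent positions `level` and
`level + 1` counted from the bottom. -/
structure StringCrossing (n : ℕ) where
  color : StringColor
  level : Fin (n - 1)
  deriving DecidableEq

namespace StringCrossing

variable {n : ℕ}

/-- The lower of the two positions that are exchanged at a crossing. -/
def lowerPos (x : StringCrossing n) : Fin n :=
  ⟨x.level.1, lt_of_lt_of_le x.level.2 (Nat.sub_le n 1)⟩

/-- The upper of the two positions that are exchanged at a crossing. -/
def upperPos (x : StringCrossing n) : Fin n :=
  ⟨x.level.1 + 1, Nat.add_lt_of_lt_sub x.level.2⟩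

/-- The order of the strings of colour `c` (from positions to labels) on a vertical line to the
right of the crossings in the list `u` and to the left of all the others. Crossings are listed from
left to right. -/
def order (c : StringColor) (u : List (StringCrossing n)) : Equiv.Perm (Fin n) :=
  u.foldl
    (fun σ x => if x.color = c then σ * Equiv.swap x.lowerPos x.upperPos else σ)
    (c.leftOrder n)

/-- The labels of the strings of colour `c` that pass below the chamber which, on the vertical line
just after the crossings in `u`, lies directly above the strings in position `k`. -/
def labelsBelow (c : StringColor) (u : List (StringCrossing n)) (k : Fin n) : Finset (Fin n) :=
  (Finset.Iic k).map (order c u).toEmbedding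

/-- The unordered pair of labels of the strings that meet at the crossing `x`, when `u` lists the
crossings to the left of `x`. -/
def crossingPair (u : List (StringCrossing n)) (x : StringCrossing n) : Sym2 (Fin n) :=
  s(order x.color u x.lowerPos, order x.color u x.upperPos)

theorem card_labelsBelow_eq (u : List (StringCrossing n)) (k : Fin n) :
    (labelsBelow .red u k).card = (labelsBelow .blue u k).card := by
  simp [labelsBelow]

end StringCrossing

/-- An index of a minor of an `n × n` matrix: a set of rows and a set of columns of the same size.
These pairs are also the chamber labels (red labels, blue labels) of double wiring diagrams. -/
@[ext]
structure MinorIndex (n : ℕ) where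
  rows : Finset (Fin n)
  cols : Finset (Fin n)
  card_eq : rows.card = cols.card

/-- The minor of `M` with the rows and the columns prescribed by `D`, in increasing order. -/
def Matrix.minorAt {n : ℕ} {R : Type*} [CommRing R] (M : Matrix (Fin n) (Fin n) R)
    (D : MinorIndex n) : R :=
  (M.submatrix (D.rows.orderEmbOfFin rfl) (D.cols.orderEmbOfFin D.card_eq.symm)).det

/-- A double wiring diagram with `n` strings of each colour, given by its sequence of crossings from
left to right: any two distinct strings of the same colour cross exactly once. -/
structure DoubleWiringDiagram (n : ℕ) where
  crossings : List (StringCrossing n)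
  crosses_once : ∀ (c : StringColor) (a b : Fin n), a ≠ b →
    ∃! t : Fin crossings.length, (crossings.get t).color = c ∧
      StringCrossing.crossingPair (crossings.take t) (crossings.get t) = s(a, b)

namespace DoubleWiringDiagram

variable {n : ℕ}

/-- The set of all chamber labels of a double wiring diagram. Each chamber meets a vertical line just
after some initial part `u` of the sequence of crossings, where it lies directly above the strings
in some position `k`. The chamber above all strings is included, the region below all of them (with
empty labels) is not. -/
def chamberLabels (w : DoubleWiringDiagram n) : Set (MinorIndex n) :=
  {D | ∃ u : List (StringCrossing n), u <+: w.crossings ∧ ∃ k : Fin n,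
    D = ⟨StringCrossing.labelsBelow .red u k, StringCrossing.labelsBelow .blue u k,
      StringCrossing.card_labelsBelow_eq u k⟩}

/-- Two double wiring diagrams are isotopic if they have the same collection of chamber labels. -/
def isotopySetoid (n : ℕ) : Setoid (DoubleWiringDiagram n) :=
  Setoid.ker chamberLabels

end DoubleWiringDiagram

/-- Commutation classes of double wiring diagrams with `n` strings of each colour. -/
def CommutationClass (n : ℕ) : Type :=
  Quotient (DoubleWiringDiagram.isotopySetoid n)

/-- The chamber labels of (any double wiring diagram in) a commutation class. -/
def CommutationClass.chamberLabels {n : ℕ} (w : CommutationClass n) : Set (MinorIndex n) :=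
  Quotient.lift DoubleWiringDiagram.chamberLabels (fun _ _ h => h) w

/-- Laurent polynomials with integer coefficients in variables indexed by `σ`. -/
abbrev MvLaurent (σ : Type*) : Type _ :=
  AddMonoidAlgebra ℤ (σ →₀ ℤ)

namespace MvLaurent

variable {σ : Type*}

/-- All the coefficients of the monomials that occur in `f` are positive. -/
def HasPositiveCoeffs (f : MvLaurent σ) : Prop :=
  ∀ m ∈ f.coeff.support, 0 < f.coeff m

/-- The value of a Laurent polynomial at a point (of interest only at points whose coordinates are
all nonzero). -/
def evalAt {K : Type*} [Field K] (x : σ → K) (f : MvLaurent σ) : K :=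
  f.coeff.sum fun m a => (a : K) * m.prod fun i e => x i ^ e

end MvLaurent

/-!
Let `S` be the semiring of functions on the space of matrices that are values of Laurent polynomials
with positive coefficients in the chamber minors. If a product `a * b` lies in `S` and `a` is a
chamber minor, then `b` lies in `S`. The minors of a `4 × 4` matrix `M` are the maximal minors of a
`4 × 8` matrix, with columns at the vertices of an octagon. Each three-term Plücker relation
`p_{ac} p_{bd} = p_{ab} p_{cd} + p_{ad} p_{bc}` therefore leads from minors in `S` to another one, if
a factor on the left hand side is a chamber minor. For some of the classes this does not reach all
minors, but it does together with a few relations that involve differences of products of Plücker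
coordinates, and their images under the symmetries of the octagon.

Up to commutation, which only removes chambers, the crossings come in a normal form, and there are
only a few thousand diagrams in normal form. For each of them, a computation with sets of minors, as
the sets of binary digits of numbers, shows that the relations lead to all minors.
-/

universe u

namespace MvLaurent

variable {σ : Type*}

theorem hasPositiveCoeffs_iff (f : MvLaurent σ) :
    f.HasPositiveCoeffs ↔ ∀ m, 0 ≤ f.coeff m := by
  refine ⟨fun h m => ?_, fun h m hm => (h m).lt_of_ne' (Finsupp.mem_support_iff.mp hm)⟩
  by_cases hm : m ∈ f.coeff.support
  · exact (h m hm).le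
  · exact (Finsupp.notMem_support_iff.mp hm).ge

theorem HasPositiveCoeffs.add {f g : MvLaurent σ} (hf : f.HasPositiveCoeffs)
    (hg : g.HasPositiveCoeffs) : (f + g).HasPositiveCoeffs := by
  rw [hasPositiveCoeffs_iff] at *
  exact fun m => add_nonneg (hf m) (hg m)

theorem HasPositiveCoeffs.mul {f g : MvLaurent σ} (hf : f.HasPositiveCoeffs)
    (hg : g.HasPositiveCoeffs) : (f * g).HasPositiveCoeffs := by
  classical
  rw [hasPositiveCoeffs_iff] at *
  intro m
  rw [AddMonoidAlgebra.coeff_mul]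
  refine Finset.sum_nonneg fun a _ => Finset.sum_nonneg fun b _ => ?_
  dsimp only
  split_ifs
  · exact mul_nonneg (hf a) (hg b)
  · exact le_rfl

theorem hasPositiveCoeffs_single (m : σ →₀ ℤ) :
    HasPositiveCoeffs (AddMonoidAlgebra.single m 1 : MvLaurent σ) := by
  classical
  rw [hasPositiveCoeffs_iff]
  intro k
  rw [AddMonoidAlgebra.coeff_single, Finsupp.single_apply]
  split_ifs
  · exact zero_le_one
  · exact le_rfl

/-- The semiring of Laurent polynomials with positive coefficients. -/
def positiveSubsemiring (σ : Type*) : Subsemiring (MvLaurent σ) where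
  carrier := {f | f.HasPositiveCoeffs}
  mul_mem' := .mul
  one_mem' := hasPositiveCoeffs_single 0
  add_mem' := .add
  zero_mem' := fun _ hm => absurd rfl (Finsupp.mem_support_iff.mp hm)

/-- The value of a Laurent monomial at a point with nonzero coordinates, as a monoid
homomorphism. -/
def monomialValue {K : Type*} [Field K] (x : σ → K) (hx : ∀ i, x i ≠ 0) :
    Multiplicative (σ →₀ ℤ) →* K where
  toFun m := (Multiplicative.toAdd m).prod fun i e => x i ^ e
  map_one' := Finsupp.prod_zero_index
  map_mul' _ _ := Finsupp.prod_add_index' (fun _ => zpow_zero _)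
    (fun i _ _ => zpow_add₀ (hx i) _ _)

/-- The ring homomorphism `MvLaurent.evalAt x`, at a point `x` with nonzero coordinates. -/
noncomputable def evalHom {K : Type*} [Field K] (x : σ → K) (hx : ∀ i, x i ≠ 0) :
    MvLaurent σ →+* K :=
  AddMonoidAlgebra.liftNCRingHom (Int.castRingHom K) (monomialValue x hx)
    (fun _ _ => Commute.all _ _)

theorem evalHom_apply {K : Type*} [Field K] (x : σ → K) (hx : ∀ i, x i ≠ 0) (f : MvLaurent σ) :
    evalHom x hx f = f.evalAt x :=
  rfl

theorem evalAt_single {K : Type*} [Field K] (x : σ → K) (m : σ →₀ ℤ) :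
    evalAt x (AddMonoidAlgebra.single m 1) = m.prod fun i e => x i ^ e := by
  simp [evalAt]

end MvLaurent

section UnitOf

variable {R : Type*} [CommRing R] {S : Subsemiring R}

/-- `a` is a unit of the semiring `S`: both `a` and an inverse of `a` belong to `S`. -/
def IsUnitOf (S : Subsemiring R) (a : R) : Prop :=
  a ∈ S ∧ ∃ b ∈ S, a * b = 1

theorem isUnitOf_one : IsUnitOf S 1 :=
  ⟨S.one_mem, 1, S.one_mem, one_mul 1⟩

theorem IsUnitOf.mem_of_mul_mem {a b : R} (ha : IsUnitOf S a) (h : a * b ∈ S) : b ∈ S := by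
  obtain ⟨-, c, hc, hac⟩ := ha
  have hb : c * (a * b) = b := by rw [← mul_assoc, mul_comm c a, hac, one_mul]
  exact hb ▸ S.mul_mem hc h

theorem IsUnitOf.map {R' : Type*} [CommRing R'] {a : R} (ha : IsUnitOf S a) (φ : R →+* R') :
    IsUnitOf (S.map φ) (φ a) := by
  obtain ⟨haS, b, hb, hab⟩ := ha
  exact ⟨Subsemiring.mem_map.mpr ⟨a, haS, rfl⟩, φ b, Subsemiring.mem_map.mpr ⟨b, hb, rfl⟩,
    by rw [← map_mul, hab, map_one]⟩

end UnitOf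

namespace MvLaurent

theorem isUnitOf_single {σ : Type*} (m : σ →₀ ℤ) :
    IsUnitOf (positiveSubsemiring σ) (AddMonoidAlgebra.single m 1) := by
  refine ⟨hasPositiveCoeffs_single m, AddMonoidAlgebra.single (-m) 1,
    hasPositiveCoeffs_single (-m), ?_⟩
  rw [AddMonoidAlgebra.single_mul_single, add_neg_cancel, mul_one]
  rfl

end MvLaurent

section Minors

variable {R : Type*} [CommRing R] {m p : ℕ} {A : Matrix (Fin m) (Fin p) R}

/-- The minor of `A` with the rows in `T` and the columns in `S`, with the convention that it is `0`
if these sets have different sizes. -/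
def finsetMinor (A : Matrix (Fin m) (Fin p) R) (T : Finset (Fin m)) (S : Finset (Fin p)) : R :=
  if h : S.card = T.card then
    (A.submatrix (T.orderEmbOfFin rfl) (S.orderEmbOfFin h)).det
  else 0

theorem finsetMinor_eq_det {k : ℕ} {f : Fin k → Fin m} {g : Fin k → Fin p} (hf : StrictMono f)
    (hg : StrictMono g) {T : Finset (Fin m)} {S : Finset (Fin p)} (hT : T.card = k)
    (hS : S.card = k) (hfT : ∀ a, f a ∈ T) (hgS : ∀ a, g a ∈ S) :
    finsetMinor A T S = (A.submatrix f g).det := by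
  subst hT
  rw [finsetMinor, dif_pos hS, Finset.orderEmbOfFin_unique rfl hfT hf,
    Finset.orderEmbOfFin_unique hS hgS hg]

theorem exists_strictMono_insert {α : Type*} [LinearOrder α] {T : Finset α} {k : ℕ}
    (hT : T.card = k) {i : α} (hi : i ∉ T) :
    ∃ (f : Fin (k + 1) → α) (q : Fin (k + 1)), StrictMono f ∧ f q = i ∧
      (∀ a, f a ∈ insert i T) ∧ (∀ a, f (q.succAbove a) ∈ T) ∧ q + (T.filter (i < ·)).card = k := by
  have hT' := (Finset.card_insert_of_notMem hi).trans (congrArg (· + 1) hT)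
  let f := (insert i T).orderEmbOfFin hT'
  have hmem (b) : b ∈ insert i T ↔ ∃ a, f a = b := by
    rw [← Set.mem_range, Finset.range_orderEmbOfFin, Finset.mem_coe]
  obtain ⟨q, hq⟩ := (hmem i).mp (Finset.mem_insert_self i T)
  have hfilter : T.filter (i < ·) = (Finset.Ioi q).map f.toEmbedding := by
    ext b
    have hb : b ∈ T ∧ i < b ↔ b ∈ insert i T ∧ i < b := by
      rw [Finset.mem_insert]
      exact ⟨fun h => ⟨.inr h.1, h.2⟩, fun h => ⟨h.1.resolve_left h.2.ne', h.2⟩⟩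
    rw [Finset.mem_filter, hb, hmem, ← hq, Finset.mem_map]
    constructor
    · rintro ⟨⟨a, rfl⟩, h⟩
      exact ⟨a, Finset.mem_Ioi.mpr (f.lt_iff_lt.mp h), rfl⟩
    · rintro ⟨a, ha, rfl⟩
      exact ⟨⟨a, rfl⟩, f.lt_iff_lt.mpr (Finset.mem_Ioi.mp ha)⟩
  refine ⟨f, q, f.strictMono, hq, fun a => (hmem _).mpr ⟨a, rfl⟩, fun a => ?_, ?_⟩
  · exact Finset.mem_of_mem_insert_of_ne ((hmem _).mpr ⟨_, rfl⟩)
      fun h => q.succAbove_ne a (f.injective (h.trans hq.symm))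
  · rw [hfilter, Finset.card_map, Fin.card_Ioi]
    omega

/-- Laplace expansion along the last column, whose only nonzero entry is in row `i`. -/
theorem finsetMinor_insert_insert {T : Finset (Fin m)} {S : Finset (Fin p)} {i : Fin m} {x : Fin p}
    (hi : i ∉ T) (hx : ∀ y ∈ S, y < x) (h0 : ∀ a ∈ T, A a x = 0)
    (hsign : A i x = (-1) ^ (T.filter (i < ·)).card) (hST : S.card = T.card) :
    finsetMinor A (insert i T) (insert x S) = finsetMinor A T S := by
  have hxS : x ∉ S := fun h => (hx x h).false
  have hlast : S.filter (x < ·) = ∅ :=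
    Finset.filter_eq_empty_iff.mpr fun y hy => (hx y hy).not_gt
  obtain ⟨f, q, hf, rfl, hf_mem, hfT, hq⟩ := exists_strictMono_insert rfl hi
  obtain ⟨g, r, hg, rfl, hg_mem, hgS, hr⟩ := exists_strictMono_insert hST hxS
  have heven : Even (q + r + (T.filter (f q < ·)).card : ℕ) := by
    rw [hlast, Finset.card_empty] at hr
    exact ⟨T.card, by omega⟩
  rw [finsetMinor_eq_det hf hg (Finset.card_insert_of_notMem hi)
      (by rw [Finset.card_insert_of_notMem hxS, hST]) hf_mem hg_mem,
    finsetMinor_eq_det (hf.comp q.strictMono_succAbove) (hg.comp r.strictMono_succAbove) rfl hST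
      hfT hgS, Matrix.det_succ_column _ r, Finset.sum_eq_single q]
  · rw [Matrix.submatrix_apply, hsign, ← pow_add, heven.neg_one_pow, one_mul,
      Matrix.submatrix_submatrix]
  · intro a _ ha
    obtain ⟨b, rfl⟩ := Fin.exists_succAbove_eq ha
    rw [Matrix.submatrix_apply, h0 _ (hfT b), mul_zero, zero_mul]
  · exact fun h => absurd (Finset.mem_univ q) h

/-- The columns `e i` of `A` are the unit vectors with alternating signs, from the last one to the
first one. -/
structure IsSignedUnitColumns (A : Matrix (Fin m) (Fin p) R) (e : Fin m → Fin p) : Prop where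
  strictAnti : StrictAnti e
  apply_self (i) : A i (e i) = (-1) ^ (m - 1 - i)
  apply_of_ne {i a} : a ≠ i → A a (e i) = 0

theorem IsSignedUnitColumns.finsetMinor_union {e : Fin m → Fin p} (he : IsSignedUnitColumns A e)
    {T : Finset (Fin m)} {S : Finset (Fin p)} (hS : ∀ y ∈ S, ∀ i, y < e i) (hST : S.card = T.card)
    {U : Finset (Fin m)} (hTU : Disjoint T U) (hU : ∀ i ∈ U, ∀ a, i < a → a ∈ T ∪ U) :
    finsetMinor A (T ∪ U) (S ∪ U.image e) = finsetMinor A T S := by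
  induction U using Finset.induction_on_min with
  | empty => simp only [Finset.image_empty, Finset.union_empty]
  | insert i U hi ih =>
    have hiU : i ∉ U := fun h => (hi i h).false
    obtain ⟨hiT, hTU⟩ := Finset.disjoint_insert_right.mp hTU
    have hcard : (S ∪ U.image e).card = (T ∪ U).card := by
      rw [Finset.card_union_of_disjoint hTU, ← hST,
        ← Finset.card_image_of_injective U he.strictAnti.injective, Finset.card_union_of_disjoint]
      exact Finset.disjoint_left.mpr fun y hy hyU => by
        obtain ⟨a, -, rfl⟩ := Finset.mem_image.mp hyU
        exact (hS _ hy a).false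
    have habove : (T ∪ U).filter (i < ·) = Finset.Ioi i := by
      ext a
      rw [Finset.mem_filter, Finset.mem_Ioi, and_iff_right_iff_imp]
      intro ha
      simpa [ha.ne'] using hU i (Finset.mem_insert_self i U) a ha
    rw [Finset.union_insert, Finset.image_insert, Finset.union_insert, finsetMinor_insert_insert]
    · refine ih hTU fun b hb a hba => ?_
      have := hU b (Finset.mem_insert_of_mem hb) a hba
      rwa [Finset.union_insert, Finset.mem_insert, or_iff_right ((hi b hb).trans hba).ne'] at this
    · simp [hiT, hiU]
    · intro y hy
      rcases Finset.mem_union.mp hy with hy | hy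
      · exact hS y hy i
      · obtain ⟨b, hb, rfl⟩ := Finset.mem_image.mp hy
        exact he.strictAnti (hi b hb)
    · refine fun a ha => he.apply_of_ne ?_
      rintro rfl
      simp [hiT, hiU] at ha
    · rw [habove, Fin.card_Ioi, he.apply_self]
    · exact hcard

theorem IsSignedUnitColumns.finsetMinor_univ {e : Fin m → Fin p} (he : IsSignedUnitColumns A e)
    {T : Finset (Fin m)} {S : Finset (Fin p)} (hS : ∀ y ∈ S, ∀ i, y < e i)
    (hST : S.card = T.card) :
    finsetMinor A Finset.univ (S ∪ Tᶜ.image e) = finsetMinor A T S := by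
  rw [← Finset.union_compl T]
  exact he.finsetMinor_union hS hST disjoint_compl_right
    fun _ _ a _ => Finset.union_compl T ▸ Finset.mem_univ a

end Minors

section MinorIndex

variable {R : Type*} [CommRing R] {n N : ℕ}

/-- `D`, as an index of a minor of a larger matrix. -/
def MinorIndex.castLE (h : n ≤ N) (D : MinorIndex n) : MinorIndex N where
  rows := D.rows.map (Fin.castLEEmb h)
  cols := D.cols.map (Fin.castLEEmb h)
  card_eq := by rw [Finset.card_map, Finset.card_map, D.card_eq]

/-- The matrix with `M` in the upper left corner and zeros elsewhere. -/
def zeroPadding (N : ℕ) (M : Matrix (Fin n) (Fin n) R) : Matrix (Fin N) (Fin N) R :=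
  Matrix.of fun i j => if h : i < n ∧ j < n then M ⟨i, h.1⟩ ⟨j, h.2⟩ else 0

theorem minorAt_eq_finsetMinor (M : Matrix (Fin n) (Fin n) R) (D : MinorIndex n) :
    M.minorAt D = finsetMinor M D.rows D.cols := by
  rw [Matrix.minorAt, finsetMinor, dif_pos D.card_eq.symm]

theorem minorAt_zeroPadding (h : n ≤ N) (M : Matrix (Fin n) (Fin n) R) (D : MinorIndex n) :
    (zeroPadding N M).minorAt (D.castLE h) = M.minorAt D := by
  have hM : M = (zeroPadding N M).submatrix (Fin.castLE h) (Fin.castLE h) := by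
    ext i j
    have hij : (Fin.castLE h i : ℕ) < n ∧ (Fin.castLE h j : ℕ) < n := ⟨i.2, j.2⟩
    rw [Matrix.submatrix_apply, zeroPadding, Matrix.of_apply, dif_pos hij]
    rfl
  conv_rhs => rw [hM]
  rw [minorAt_eq_finsetMinor, Matrix.minorAt, Matrix.submatrix_submatrix]
  refine finsetMinor_eq_det ((Fin.strictMono_castLE h).comp (D.rows.orderEmbOfFin rfl).strictMono)
    ((Fin.strictMono_castLE h).comp (D.cols.orderEmbOfFin _).strictMono) (Finset.card_map _)
    ((Finset.card_map _).trans D.card_eq.symm) (fun a => ?_) (fun a => ?_)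
  all_goals exact Finset.mem_map_of_mem (Fin.castLEEmb h) (Finset.orderEmbOfFin_mem _ _ a)

/-- `M`, followed by the unit vectors with alternating signs in reverse order. The maximal minors of
this matrix are the minors of `M`. -/
def signedExtension (M : Matrix (Fin N) (Fin N) R) : Matrix (Fin N) (Fin (N + N)) R :=
  Matrix.of fun i => Fin.append (M i) fun j => if i = j.rev then (-1) ^ (N - 1 - i) else 0

/-- The columns of `signedExtension M` in the maximal minor that equals `M.minorAt D`. -/
def MinorIndex.places (D : MinorIndex N) : Finset (Fin (N + N)) :=
  D.cols.map (Fin.castAddEmb N) ∪ D.rowsᶜ.image fun i => Fin.natAdd N i.rev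

theorem finsetMinor_signedExtension (M : Matrix (Fin N) (Fin N) R) (D : MinorIndex N) :
    finsetMinor (signedExtension M) Finset.univ D.places = M.minorAt D := by
  have hunit : IsSignedUnitColumns (signedExtension M) fun i => Fin.natAdd N i.rev :=
    { strictAnti := fun i j hij => (Fin.strictMono_natAdd N) (Fin.rev_lt_rev.mpr hij)
      apply_self := fun i => by
        rw [signedExtension, Matrix.of_apply, Fin.append_right, Fin.rev_rev, if_pos rfl]
      apply_of_ne := fun h => by
        rw [signedExtension, Matrix.of_apply, Fin.append_right, Fin.rev_rev, if_neg h] }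
  have hM : M = (signedExtension M).submatrix id (Fin.castAdd N) := by
    ext i j
    rw [Matrix.submatrix_apply, signedExtension, Matrix.of_apply, Fin.append_left, id]
  have hcard := (Finset.card_map (Fin.castAddEmb N)).trans D.card_eq.symm
  rw [MinorIndex.places, hunit.finsetMinor_univ _ hcard]
  · conv_rhs => rw [hM]
    rw [Matrix.minorAt, Matrix.submatrix_submatrix]
    refine finsetMinor_eq_det (D.rows.orderEmbOfFin rfl).strictMono
      ((Fin.strictMono_castAdd N).comp (D.cols.orderEmbOfFin _).strictMono) rfl hcard
      (fun a => Finset.orderEmbOfFin_mem _ _ a) (fun a => ?_)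
    exact Finset.mem_map_of_mem (Fin.castAddEmb N) (Finset.orderEmbOfFin_mem _ _ a)
  · intro y hy i
    obtain ⟨j, -, rfl⟩ := Finset.mem_map.mp hy
    exact j.2.trans_le (Nat.le_add_right N i.rev)

end MinorIndex

namespace StringCrossing

variable {n : ℕ}

theorem lowerPos_lt_upperPos (x : StringCrossing n) : x.lowerPos < x.upperPos :=
  Nat.lt_succ_self x.level.val

/-- The orders of the strings of both colours on a vertical line, from positions to labels. -/
abbrev Orders (n : ℕ) : Type := StringColor → Equiv.Perm (Fin n)

/-- The orders of the strings just after the crossings in `u`. -/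
def ordersAfter (u : List (StringCrossing n)) : Orders n := fun c => order c u

/-- The orders of the strings just after the crossing `x`, given those just before. -/
def cross (s : Orders n) (x : StringCrossing n) : Orders n := fun c =>
  if x.color = c then s c * Equiv.swap x.lowerPos x.upperPos else s c

theorem ordersAfter_append_singleton (u : List (StringCrossing n)) (x : StringCrossing n) :
    ordersAfter (u ++ [x]) = cross (ordersAfter u) x :=
  funext fun _ => List.foldl_append

/-- The string `a` of colour `c` runs below the string `b` of this colour. -/
def RunsBelow (s : Orders n) (c : StringColor) (a b : Fin n) : Prop :=
  (s c).symm a < (s c).symm b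

theorem runsBelow_apply (s : Orders n) (c : StringColor) (p q : Fin n) :
    RunsBelow s c (s c p) (s c q) ↔ p < q := by
  simp only [RunsBelow, Equiv.symm_apply_apply]

theorem runsBelow_lowerPos_upperPos (s : Orders n) (x : StringCrossing n) :
    RunsBelow s x.color (s x.color x.lowerPos) (s x.color x.upperPos) :=
  (runsBelow_apply s _ _ _).mpr x.lowerPos_lt_upperPos

theorem apply_lowerPos_ne (s : Orders n) (x : StringCrossing n) :
    s x.color x.lowerPos ≠ s x.color x.upperPos :=
  (s x.color).injective.ne x.lowerPos_lt_upperPos.ne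

/-- The crossing `x`, on a vertical line where the orders of the strings are `s`, is a crossing of
the strings `a` and `b` of colour `c`. -/
def IsCrossingOf (s : Orders n) (x : StringCrossing n) (c : StringColor) (a b : Fin n) : Prop :=
  x.color = c ∧ s(s x.color x.lowerPos, s x.color x.upperPos) = s(a, b)

theorem runsBelow_cross_of_not_isCrossingOf {s : Orders n} {x : StringCrossing n}
    {c : StringColor} {a b : Fin n} (hab : a ≠ b) (h : ¬ IsCrossingOf s x c a b) :
    RunsBelow (cross s x) c a b ↔ RunsBelow s c a b := by
  by_cases hc : x.color = c
  · subst hc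
    obtain ⟨p, rfl⟩ := (s x.color).surjective a
    obtain ⟨q, rfl⟩ := (s x.color).surjective b
    have hpq : p ≠ q := fun e => hab (e ▸ rfl)
    simp only [IsCrossingOf, Sym2.eq_iff, EmbeddingLike.apply_eq_iff_eq, true_and, not_or,
      not_and] at h
    simp only [RunsBelow, cross, if_true, Equiv.Perm.mul_def, Equiv.symm_trans_apply,
      Equiv.symm_swap, Equiv.symm_apply_apply, Equiv.swap_apply_def]
    simp only [Fin.ext_iff, Fin.lt_def, ne_eq, lowerPos, upperPos] at *
    split_ifs <;> simp only [] <;> omega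
  · simp only [RunsBelow, cross, if_neg hc]

theorem IsCrossingOf.runsBelow_cross {s : Orders n} {x : StringCrossing n} {c : StringColor}
    {a b : Fin n} (h : IsCrossingOf s x c a b) :
    RunsBelow (cross s x) c a b ↔ ¬ RunsBelow s c a b := by
  obtain ⟨rfl, h⟩ := h
  have hlt := x.lowerPos_lt_upperPos
  rcases Sym2.eq_iff.mp h with ⟨rfl, rfl⟩ | ⟨rfl, rfl⟩ <;>
    simp only [RunsBelow, cross, if_true, Equiv.Perm.mul_def, Equiv.symm_trans_apply,
      Equiv.symm_swap, Equiv.symm_apply_apply, Equiv.swap_apply_left,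
      Equiv.swap_apply_right, hlt, hlt.not_gt, not_true, not_false_iff]

theorem runsBelow_ordersAfter_append {c : StringColor} {a b : Fin n} (hab : a ≠ b)
    (u v : List (StringCrossing n))
    (h : ∀ v₁ x v₂, v = v₁ ++ x :: v₂ → ¬ IsCrossingOf (ordersAfter (u ++ v₁)) x c a b) :
    RunsBelow (ordersAfter (u ++ v)) c a b ↔ RunsBelow (ordersAfter u) c a b := by
  induction v using List.reverseRecOn with
  | nil => rw [List.append_nil]
  | append_singleton v x ih =>
    rw [← List.append_assoc, ordersAfter_append_singleton,
      runsBelow_cross_of_not_isCrossingOf hab (h v x [] rfl)]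
    exact ih fun v₁ y v₂ hv => h v₁ y (v₂ ++ [x]) (by simp [hv])

/-- The two strings that meet at `x` are in the same order as at the left end of the diagram; in a
diagram where any two strings cross once, they have not met before. -/
def IsLegal (s : Orders n) (x : StringCrossing n) : Prop :=
  RunsBelow (ordersAfter []) x.color (s x.color x.lowerPos) (s x.color x.upperPos)

/-- Starting from the orders `s`, the word `w` only has legal crossings, and no legal crossing is
left at its end. -/
def IsComplete (s : Orders n) : List (StringCrossing n) → Prop
  | [] => ∀ x, ¬ IsLegal s x
  | x :: w => IsLegal s x ∧ IsComplete (cross s x) w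

/-- The labels of the lowest `k` strings. -/
def below (σ : Equiv.Perm (Fin n)) (k : ℕ) : Finset (Fin n) :=
  (Finset.univ.filter fun p : Fin n => p.val < k).map σ.toEmbedding

theorem mem_below {σ : Equiv.Perm (Fin n)} {k : ℕ} {a : Fin n} :
    a ∈ below σ k ↔ (σ.symm a).val < k := by
  simp [below, Finset.mem_map_equiv]

theorem card_below_eq (σ τ : Equiv.Perm (Fin n)) (k : ℕ) :
    (below σ k).card = (below τ k).card := by
  simp only [below, Finset.card_map]

theorem labelsBelow_eq_below (c : StringColor) (u : List (StringCrossing n)) (k : Fin n) :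
    labelsBelow c u k = below (ordersAfter u c) (k.val + 1) := by
  refine congrArg (Finset.map _) (Finset.ext fun p => ?_)
  simp only [Finset.mem_Iic, Finset.mem_filter, Finset.mem_univ, true_and, Fin.le_def,
    Nat.lt_succ_iff]

/-- The label of the chamber above `k` strings of each colour. -/
def chamberAt (s : Orders n) (k : ℕ) : MinorIndex n :=
  ⟨below (s .red) k, below (s .blue) k, card_below_eq _ _ k⟩

theorem chamberAt_min (s : Orders n) (k : ℕ) : chamberAt s (min k n) = chamberAt s k := by
  have below_min (σ : Equiv.Perm (Fin n)) : below σ (min k n) = below σ k := by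
    ext a
    simp only [mem_below]
    omega
  exact MinorIndex.ext (below_min _) (below_min _)

/-- The labels of the chambers that a vertical line meets, including the one below all strings. -/
def chambersAt (s : Orders n) : Set (MinorIndex n) := Set.range (chamberAt s)

/-- The labels of the chambers that are met by the word `w` when it starts from `s`. -/
def chambers (s : Orders n) : List (StringCrossing n) → Set (MinorIndex n)
  | [] => chambersAt s
  | x :: w => chambersAt s ∪ chambers (cross s x) w

theorem chambersAt_subset_chambers (s : Orders n) (w : List (StringCrossing n)) :
    chambersAt s ⊆ chambers s w := by
  cases w with
  | nil => exact subset_rfl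
  | cons x w => exact Set.subset_union_left

theorem below_mul_swap (σ : Equiv.Perm (Fin n)) (x : StringCrossing n) {k : ℕ}
    (hk : k ≠ x.level.val + 1) :
    below (σ * Equiv.swap x.lowerPos x.upperPos) k = below σ k := by
  ext a
  simp only [mem_below, Equiv.Perm.mul_def, Equiv.symm_trans_apply, Equiv.symm_swap,
    Equiv.swap_apply_def, Fin.ext_iff, lowerPos, upperPos]
  split_ifs <;> simp only [] <;> omega

theorem below_cross (s : Orders n) (x : StringCrossing n) (c : StringColor) {k : ℕ}
    (hk : k ≠ x.level.val + 1) : below (cross s x c) k = below (s c) k := by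
  unfold cross
  split_ifs
  · exact below_mul_swap _ _ hk
  · rfl

theorem chamberAt_cross (s : Orders n) (x : StringCrossing n) {k : ℕ}
    (hk : k ≠ x.level.val + 1) : chamberAt (cross s x) k = chamberAt s k :=
  MinorIndex.ext (below_cross s x .red hk) (below_cross s x .blue hk)

/-- The crossings `x` and `y` can be interchanged when they follow each other, without a change of
the set of chamber labels. -/
def Commutes (x y : StringCrossing n) : Prop :=
  x.level ≠ y.level ∧
    (x.color = y.color → x.level.val + 1 ≠ y.level.val ∧ y.level.val + 1 ≠ x.level.val)

theorem Commutes.symm {x y : StringCrossing n} (h : Commutes x y) : Commutes y x :=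
  ⟨h.1.symm, fun e => (h.2 e.symm).symm⟩

theorem Commutes.pos_ne {x y : StringCrossing n} (h : Commutes x y) (e : x.color = y.color) :
    x.lowerPos ≠ y.lowerPos ∧ x.lowerPos ≠ y.upperPos ∧ x.upperPos ≠ y.lowerPos ∧
      x.upperPos ≠ y.upperPos := by
  have hne := Fin.val_ne_of_ne h.1
  have hadj := h.2 e
  simp only [ne_eq, Fin.ext_iff, lowerPos, upperPos]
  omega

theorem Commutes.cross_cross {x y : StringCrossing n} (h : Commutes x y) (s : Orders n) :
    cross (cross s x) y = cross (cross s y) x := by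
  funext c
  unfold cross
  split_ifs with hy hx
  · obtain ⟨hll, hlu, hul, huu⟩ := h.pos_ne (hx.trans hy.symm)
    have hdisj : (Equiv.swap x.lowerPos x.upperPos).Disjoint
        (Equiv.swap y.lowerPos y.upperPos) := by
      rw [Equiv.Perm.disjoint_iff_disjoint_support,
        Equiv.Perm.support_swap x.lowerPos_lt_upperPos.ne,
        Equiv.Perm.support_swap y.lowerPos_lt_upperPos.ne]
      simp [hll.symm, hlu.symm, hul.symm, huu.symm]
    rw [mul_assoc, mul_assoc, hdisj.commute.eq]
  all_goals rfl

theorem Commutes.isLegal_cross_iff {x y : StringCrossing n} (h : Commutes x y) (s : Orders n) :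
    IsLegal (cross s x) y ↔ IsLegal s y := by
  unfold IsLegal cross
  split_ifs with e
  · obtain ⟨hll, hlu, hul, huu⟩ := h.pos_ne e
    rw [Equiv.Perm.mul_apply, Equiv.Perm.mul_apply, Equiv.swap_apply_of_ne_of_ne hll.symm hul.symm,
      Equiv.swap_apply_of_ne_of_ne hlu.symm huu.symm]
  · rfl

theorem Commutes.isComplete_swap {x y : StringCrossing n} (h : Commutes x y)
    (u v : List (StringCrossing n)) (s : Orders n) (hw : IsComplete s (u ++ x :: y :: v)) :
    IsComplete s (u ++ y :: x :: v) := by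
  induction u generalizing s with
  | nil =>
    obtain ⟨hx, hy, hv⟩ := hw
    exact ⟨(h.isLegal_cross_iff s).mp hy, (h.symm.isLegal_cross_iff s).mpr hx,
      h.cross_cross s ▸ hv⟩
  | cons z u ih => exact ⟨hw.1, ih _ hw.2⟩

theorem Commutes.chambersAt_cross_subset {x y : StringCrossing n} (h : Commutes x y)
    (s : Orders n) :
    chambersAt (cross s y) ⊆ chambersAt s ∪ chambersAt (cross (cross s x) y) := by
  rintro D ⟨k, rfl⟩
  by_cases e : k = y.level.val + 1
  · refine Or.inr ⟨k, ?_⟩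
    have hne := Fin.val_ne_of_ne h.1
    rw [h.cross_cross, chamberAt_cross (cross s y) x (by omega)]
  · exact Or.inl ⟨k, (chamberAt_cross s y e).symm⟩

theorem Commutes.chambers_swap_subset {x y : StringCrossing n} (h : Commutes x y)
    (u v : List (StringCrossing n)) (s : Orders n) :
    chambers s (u ++ y :: x :: v) ⊆ chambers s (u ++ x :: y :: v) := by
  induction u generalizing s with
  | nil =>
    refine Set.union_subset Set.subset_union_left (Set.union_subset ?_ ?_)
    · refine (h.chambersAt_cross_subset s).trans (Set.union_subset_union_right _ ?_)
      exact (chambersAt_subset_chambers _ v).trans Set.subset_union_right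
    · rw [← h.cross_cross]
      exact Set.subset_union_right.trans Set.subset_union_right
  | cons z u ih => exact Set.union_subset_union_right _ (ih _)

/-- The crossings `x` and `y` may follow each other in a word in normal form. If they may not, then
they commute, and `y` is at a lower level than `x`. -/
def InOrder (x y : StringCrossing n) : Prop :=
  x.level.val ≤ y.level.val ∨ (x.color = y.color ∧ x.level.val ≤ y.level.val + 1)

theorem level_lt_of_not_inOrder {x y : StringCrossing n} (h : ¬ InOrder x y) :
    y.level.val < x.level.val :=
  not_le.mp (not_or.mp h).1

theorem commutes_of_not_inOrder {x y : StringCrossing n} (h : ¬ InOrder x y) : Commutes x y := by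
  obtain ⟨hle, hadj⟩ := not_or.mp h
  refine ⟨fun e => hle (by rw [e]), fun e => ?_⟩
  have := (not_and.mp hadj) e
  omega

/-- The sum of the levels, weighted by the distances from the right end. It decreases when two
crossings that are not in order are interchanged. -/
def weight : List (StringCrossing n) → ℕ
  | [] => 0
  | x :: w => x.level.val * (w.length + 1) + weight w

theorem weight_swap_lt {x y : StringCrossing n} (h : y.level.val < x.level.val)
    (u v : List (StringCrossing n)) :
    weight (u ++ y :: x :: v) < weight (u ++ x :: y :: v) := by
  induction u with
  | nil => simp only [List.nil_append, weight, List.length_cons]; nlinarith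
  | cons z u ih => simpa [weight] using ih

theorem IsComplete.exists_isChain_inOrder {s : Orders n} {w : List (StringCrossing n)}
    (hw : IsComplete s w) :
    ∃ w', IsComplete s w' ∧ w'.IsChain InOrder ∧ chambers s w' ⊆ chambers s w := by
  induction hk : weight w using Nat.strong_induction_on generalizing w with
  | _ k ih =>
    by_cases hc : w.IsChain InOrder
    · exact ⟨w, hw, hc, subset_rfl⟩
    · rw [List.isChain_iff_forall_rel_of_append_cons_cons] at hc
      push Not at hc
      obtain ⟨x, y, u, v, rfl, hxy⟩ := hc
      have hcomm := commutes_of_not_inOrder hxy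
      obtain ⟨w', hcomplete, hchain, hsub⟩ :=
        ih _ (hk ▸ weight_swap_lt (level_lt_of_not_inOrder hxy) u v)
          (hcomm.isComplete_swap u v s hw) rfl
      exact ⟨w', hcomplete, hchain, hsub.trans (hcomm.chambers_swap_subset u v s)⟩

end StringCrossing

namespace DoubleWiringDiagram

open StringCrossing

variable {n : ℕ} (w : DoubleWiringDiagram n)

theorem chambersAt_ordersAfter_subset {u : List (StringCrossing n)} (hu : u <+: w.crossings) :
    chambersAt (ordersAfter u) ⊆ w.chamberLabels ∪ {D | D.rows = ∅} := by
  rintro D ⟨k, rfl⟩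
  rw [← chamberAt_min]
  rcases hk : min k n with _ | j
  · refine Or.inr (Finset.eq_empty_of_forall_notMem fun a ha => ?_)
    exact Nat.not_lt_zero _ (mem_below.mp ha)
  · exact Or.inl ⟨u, hu, ⟨j, by omega⟩, MinorIndex.ext (labelsBelow_eq_below .red u ⟨j, _⟩).symm
      (labelsBelow_eq_below .blue u ⟨j, _⟩).symm⟩

theorem chambers_ordersAfter_subset {u v : List (StringCrossing n)} (h : w.crossings = u ++ v) :
    chambers (ordersAfter u) v ⊆ w.chamberLabels ∪ {D | D.rows = ∅} := by
  induction v generalizing u with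
  | nil => exact w.chambersAt_ordersAfter_subset ⟨[], h.symm⟩
  | cons x v ih =>
    refine Set.union_subset (w.chambersAt_ordersAfter_subset ⟨x :: v, h.symm⟩) ?_
    rw [← ordersAfter_append_singleton]
    exact ih (by simpa using h)

theorem exists_isCrossingOf (c : StringColor) {a b : Fin n} (hab : a ≠ b) :
    ∃ u x v, w.crossings = u ++ x :: v ∧ IsCrossingOf (ordersAfter u) x c a b := by
  obtain ⟨t, ht, -⟩ := w.crosses_once c a b hab
  exact ⟨w.crossings.take t, w.crossings.get t, w.crossings.drop (t + 1), by simp, ht⟩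

theorem length_eq_of_isCrossingOf {c : StringColor} {a b : Fin n} (hab : a ≠ b)
    {u v u' v' : List (StringCrossing n)} {x x' : StringCrossing n}
    (h : w.crossings = u ++ x :: v) (hx : IsCrossingOf (ordersAfter u) x c a b)
    (h' : w.crossings = u' ++ x' :: v') (hx' : IsCrossingOf (ordersAfter u') x' c a b) :
    u.length = u'.length := by
  obtain ⟨t, -, ht⟩ := w.crosses_once c a b hab
  have length_eq {u v : List (StringCrossing n)} {x : StringCrossing n}
      (h : w.crossings = u ++ x :: v) (hx : IsCrossingOf (ordersAfter u) x c a b) :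
      u.length = t.val := by
    have hlt : u.length < w.crossings.length := by simp [h]
    have hget : w.crossings.get ⟨u.length, hlt⟩ = x := by simp [h]
    have htake : w.crossings.take u.length = u := by simp [h]
    exact congrArg Fin.val (ht ⟨u.length, hlt⟩ (by simp only [hget, htake]; exact hx))
  rw [length_eq h hx, length_eq h' hx']

theorem runsBelow_iff_of_isCrossingOf {c : StringColor} {a b : Fin n} (hab : a ≠ b)
    {u v : List (StringCrossing n)} {x : StringCrossing n} (h : w.crossings = u ++ x :: v)
    (hx : IsCrossingOf (ordersAfter u) x c a b) :
    RunsBelow (ordersAfter u) c a b ↔ RunsBelow (ordersAfter []) c a b := by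
  refine runsBelow_ordersAfter_append hab [] u fun u₁ y u₂ hu hy => ?_
  have := w.length_eq_of_isCrossingOf (v := u₂ ++ x :: v) hab (by simp [h, hu]) hy h hx
  simp [hu] at this

theorem runsBelow_crossings_iff {c : StringColor} {a b : Fin n} (hab : a ≠ b) :
    RunsBelow (ordersAfter w.crossings) c a b ↔ ¬ RunsBelow (ordersAfter []) c a b := by
  obtain ⟨u, x, v, h, hx⟩ := w.exists_isCrossingOf c hab
  rw [← w.runsBelow_iff_of_isCrossingOf hab h hx, ← hx.runsBelow_cross,
    ← ordersAfter_append_singleton, show w.crossings = (u ++ [x]) ++ v by simp [h]]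
  refine runsBelow_ordersAfter_append hab (u ++ [x]) v fun v₁ y v₂ hv hy => ?_
  have := w.length_eq_of_isCrossingOf (v := v₂) hab (by simp [h, hv]) hy h hx
  simp at this

theorem isComplete_ordersAfter {u v : List (StringCrossing n)} (h : w.crossings = u ++ v) :
    IsComplete (ordersAfter u) v := by
  induction v generalizing u with
  | nil =>
    intro x hx
    rw [List.append_nil] at h
    exact (w.runsBelow_crossings_iff (apply_lowerPos_ne _ x)).mp
      (h ▸ runsBelow_lowerPos_upperPos _ x) hx
  | cons x v ih =>
    refine ⟨(w.runsBelow_iff_of_isCrossingOf (apply_lowerPos_ne _ x) h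
      ⟨rfl, rfl⟩).mp (runsBelow_lowerPos_upperPos _ x), ?_⟩
    rw [← ordersAfter_append_singleton]
    exact ih (by simpa using h)

theorem exists_isComplete_isChain :
    ∃ v, IsComplete (ordersAfter []) v ∧ v.IsChain (InOrder (n := n)) ∧
      chambers (ordersAfter []) v ⊆ w.chamberLabels ∪ {D | D.rows = ∅} := by
  obtain ⟨v, hcomplete, hchain, hsub⟩ :=
    (w.isComplete_ordersAfter (u := []) rfl).exists_isChain_inOrder
  exact ⟨v, hcomplete, hchain, hsub.trans (w.chambers_ordersAfter_subset rfl)⟩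

end DoubleWiringDiagram

section Plucker

variable {R : Type*} [CommRing R] {r N : ℕ}

/-- Cramer's rule expresses row `i` of `A` in terms of the rows of `B`. -/
theorem det_mul_det_eq_sum_exchange (A B : Matrix (Fin r) (Fin r) R) (i : Fin r) :
    A.det * B.det = ∑ j, (A.updateRow i (B j)).det * (B.updateRow j (A i)).det := by
  have hcramer : B.det • A i = ∑ j, (B.updateRow j (A i)).det • B j := by
    rw [← Matrix.det_transpose B, ← Matrix.mulVec_cramer]
    ext k
    simp only [Matrix.mulVec, dotProduct, Matrix.transpose_apply, Matrix.cramer_transpose_apply,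
      Finset.sum_apply, Pi.smul_apply, smul_eq_mul, mul_comm]
  have hlinear := congrArg (fun x => (A.updateRow i x).det) hcramer
  have hsum := map_sum (Matrix.detRowAlternating.toMultilinearMap.toLinearMap A i)
    (fun j => (B.updateRow j (A i)).det • B j) Finset.univ
  simp only [Matrix.det_updateRow_smul, Matrix.updateRow_eq_self] at hlinear
  rw [mul_comm, hlinear]
  refine hsum.trans (Finset.sum_congr rfl fun j _ => ?_)
  exact (Matrix.det_updateRow_smul A i _ _).trans (mul_comm _ _)

/-- The sign of the permutation that sorts `s`, or `0` if `s` is not injective. -/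
def orderSign (s : Fin r → Fin N) : ℤ :=
  Int.sign (∏ a, ∏ b ∈ Finset.Ioi a, ((s b : ℤ) - s a))

theorem orderSign_eq_sign_det_vandermonde (s : Fin r → Fin N) :
    orderSign s = Int.sign (Matrix.vandermonde fun a => (s a : ℤ)).det := by
  rw [Matrix.det_vandermonde, orderSign]

theorem orderSign_comp_perm (s : Fin r → Fin N) (σ : Equiv.Perm (Fin r)) :
    orderSign (s ∘ σ) = Equiv.Perm.sign σ * orderSign s := by
  have hdet := Matrix.det_permute σ (Matrix.vandermonde fun a => (s a : ℤ))
  have hsign : Int.sign (Equiv.Perm.sign σ) = Equiv.Perm.sign σ := by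
    rcases Int.units_eq_one_or (Equiv.Perm.sign σ) with h | h <;> rw [h] <;> rfl
  rw [orderSign_eq_sign_det_vandermonde, orderSign_eq_sign_det_vandermonde, ← hsign,
    ← Int.sign_mul]
  exact congrArg Int.sign hdet

theorem orderSign_eq_one_of_strictMono {s : Fin r → Fin N} (hs : StrictMono s) : orderSign s = 1 :=
  Int.sign_eq_one_of_pos <| Finset.prod_pos fun _ _ => Finset.prod_pos fun _ hb =>
    sub_pos.mpr <| Int.ofNat_lt.mpr <| hs (Finset.mem_Ioi.mp hb)

theorem orderSign_eq_zero {s : Fin r → Fin N} {a b : Fin r} (hab : a ≠ b) (h : s a = s b) :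
    orderSign s = 0 := by
  rw [orderSign_eq_sign_det_vandermonde, Matrix.det_zero_of_row_eq hab, Int.sign_zero]
  ext k
  rw [Matrix.vandermonde_apply, Matrix.vandermonde_apply, h]

/-- Binary code of a set of places. -/
def placeCode (s : Fin r → Fin N) : ℕ :=
  ∑ a, 2 ^ (s a : ℕ)

/-- The maximal minors of a fixed `N × r` matrix are the values of `p` at the codes of their sets of
rows. -/
def IsPlucker (r N : ℕ) (p : ℕ → R) : Prop :=
  ∃ V : Matrix (Fin N) (Fin r) R, ∀ s : Fin r → Fin N, StrictMono s →
    p (placeCode s) = (V.submatrix s id).det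

/-- The alternating function of places that belongs to `p`. -/
def placeBracket (p : ℕ → R) (s : Fin r → Fin N) : R :=
  (orderSign s : R) * p (placeCode s)

theorem placeBracket_comp_perm (p : ℕ → R) (s : Fin r → Fin N) (σ : Equiv.Perm (Fin r)) :
    placeBracket p (s ∘ σ) = (Equiv.Perm.sign σ : ℤ) * placeBracket p s := by
  rw [placeBracket, placeBracket, orderSign_comp_perm, Int.cast_mul, mul_assoc]
  congr 3
  exact Equiv.sum_comp σ fun a => 2 ^ (s a : ℕ)

theorem IsPlucker.exists_placeBracket_eq_det {p : ℕ → R} (hp : IsPlucker r N p) :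
    ∃ V : Matrix (Fin N) (Fin r) R, ∀ s : Fin r → Fin N,
      placeBracket p s = (V.submatrix s id).det := by
  obtain ⟨V, hV⟩ := hp
  refine ⟨V, fun s => ?_⟩
  by_cases hs : Function.Injective s
  · have hsort : StrictMono (s ∘ Tuple.sort s) :=
      (Tuple.monotone_sort s).strictMono_of_injective (hs.comp (Tuple.sort s).injective)
    have hsorted : placeBracket p (s ∘ Tuple.sort s) =
        ((V.submatrix s id).submatrix (Tuple.sort s) id).det := by
      rw [placeBracket, orderSign_eq_one_of_strictMono hsort, Int.cast_one, one_mul, hV _ hsort]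
      rfl
    rw [placeBracket_comp_perm, Matrix.det_permute] at hsorted
    exact ((Equiv.Perm.sign (Tuple.sort s)).isUnit.map (Int.castRingHom R)).mul_left_cancel hsorted
  · obtain ⟨a, b, hab, hne⟩ := Function.not_injective_iff.mp hs
    rw [placeBracket, orderSign_eq_zero hne hab, Int.cast_zero, zero_mul,
      Matrix.det_zero_of_row_eq hne]
    exact funext fun k => congrArg (V · k) hab

theorem IsPlucker.exchange {p : ℕ → R} (hp : IsPlucker r N p) (s t : Fin r → Fin N) (i : Fin r) :
    placeBracket p s * placeBracket p t = ∑ j, placeBracket p (Function.update s i (t j)) *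
      placeBracket p (Function.update t j (s i)) := by
  obtain ⟨V, hV⟩ := hp.exists_placeBracket_eq_det
  have hrow (s : Fin r → Fin N) (i : Fin r) (x : Fin N) :
      V.submatrix (Function.update s i x) id = (V.submatrix s id).updateRow i (V x) :=
    Function.comp_update V s i x
  simp only [hV, hrow]
  exact det_mul_det_eq_sum_exchange _ _ i

theorem IsPlucker.relabel {p : ℕ → R} (hp : IsPlucker r N p) {f : ℕ → ℕ} (τ : Fin N → Fin N)
    (ε : Fin N → ℤ) (hf : ∀ s : Fin r → Fin N, StrictMono s → f (placeCode s) = placeCode (τ ∘ s))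
    (hε : ∀ s : Fin r → Fin N, StrictMono s → (∏ a, ε (s a)) * orderSign (τ ∘ s) = 1) :
    IsPlucker r N fun m => p (f m) := by
  obtain ⟨V, hV⟩ := hp.exists_placeBracket_eq_det
  refine ⟨Matrix.of fun x j => (ε x : R) * V (τ x) j, fun s hs => ?_⟩
  have hdet := Matrix.det_mul_column (fun a => (ε (s a) : R)) (V.submatrix (τ ∘ s) id)
  rw [← hV, placeBracket, ← mul_assoc, ← Int.cast_prod, ← Int.cast_mul, hε s hs, Int.cast_one,
    one_mul, ← hf s hs] at hdet
  exact hdet.symm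

/-- The function that takes the binary code of a set of columns of `A` to the maximal minor of `A`
with these columns. -/
def maximalMinor (A : Matrix (Fin r) (Fin N) R) (m : ℕ) : R :=
  finsetMinor A Finset.univ (Finset.univ.filter fun x : Fin N => m.testBit x)

theorem testBit_sum_two_pow (S : Finset (Fin N)) (x : Fin N) :
    (∑ y ∈ S, 2 ^ (y : ℕ)).testBit x ↔ x ∈ S := by
  have hmap : ∑ y ∈ S, 2 ^ (y : ℕ) = ∑ y ∈ S.map Fin.valEmbedding, 2 ^ y :=
    (Finset.sum_map S Fin.valEmbedding (2 ^ ·)).symm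
  rw [hmap, ← Nat.mem_bitIndices, ← List.mem_toFinset, Finset.toFinset_bitIndices_sum_two_pow]
  exact Finset.mem_map' Fin.valEmbedding

theorem maximalMinor_sum_two_pow (A : Matrix (Fin r) (Fin N) R) (S : Finset (Fin N)) :
    maximalMinor A (∑ y ∈ S, 2 ^ (y : ℕ)) = finsetMinor A Finset.univ S := by
  simp only [maximalMinor, testBit_sum_two_pow, Finset.filter_mem_eq_inter, Finset.univ_inter]

theorem isPlucker_maximalMinor (A : Matrix (Fin r) (Fin N) R) :
    IsPlucker r N (maximalMinor A) := by
  refine ⟨A.transpose, fun s hs => ?_⟩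
  have hcode : placeCode s = ∑ y ∈ Finset.univ.image s, 2 ^ (y : ℕ) :=
    (Finset.sum_image (f := fun y : Fin N => 2 ^ (y : ℕ)) hs.injective.injOn).symm
  rw [hcode, maximalMinor_sum_two_pow, finsetMinor_eq_det strictMono_id hs (Finset.card_fin r)
    ((Finset.card_image_of_injective _ hs.injective).trans (Finset.card_fin r))
    (fun _ => Finset.mem_univ _) (fun a => Finset.mem_image_of_mem s (Finset.mem_univ a)),
    ← Matrix.det_transpose, Matrix.transpose_submatrix]

end Plucker

section FourRows

variable {R : Type*} [CommRing R] {N : ℕ} {p : ℕ → R}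

theorem IsPlucker.exchange_vec (hp : IsPlucker 4 N p) (x y z t a b c d : Fin N) :
    placeBracket p ![x, y, z, t] * placeBracket p ![a, b, c, d] =
      placeBracket p ![x, y, z, a] * placeBracket p ![t, b, c, d] +
      placeBracket p ![x, y, z, b] * placeBracket p ![a, t, c, d] +
      placeBracket p ![x, y, z, c] * placeBracket p ![a, b, t, d] +
      placeBracket p ![x, y, z, d] * placeBracket p ![a, b, c, t] := by
  have hlast (u : Fin N) : Function.update ![x, y, z, t] 3 u = ![x, y, z, u] := by
    ext k; fin_cases k <;> rfl
  have h0 : Function.update ![a, b, c, d] 0 t = ![t, b, c, d] := by ext k; fin_cases k <;> rfl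
  have h1 : Function.update ![a, b, c, d] 1 t = ![a, t, c, d] := by ext k; fin_cases k <;> rfl
  have h2 : Function.update ![a, b, c, d] 2 t = ![a, b, t, d] := by ext k; fin_cases k <;> rfl
  have h3 : Function.update ![a, b, c, d] 3 t = ![a, b, c, t] := by ext k; fin_cases k <;> rfl
  have hexchange := hp.exchange ![x, y, z, t] ![a, b, c, d] 3
  simp only [hlast, Fin.sum_univ_four] at hexchange
  rw [← h0, ← h1, ← h2, ← h3]
  exact hexchange

theorem orderSign_pair (x y : Fin N) :
    orderSign ![x, y] = if x < y then 1 else if y < x then -1 else 0 := by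
  rcases lt_trichotomy x y with h | rfl | h
  · simp [orderSign, Fin.prod_univ_succ, h]
  · simp [orderSign, Fin.prod_univ_succ]
  · simp [orderSign, Fin.prod_univ_succ, h, h.not_gt]

theorem orderSign_vec (x y z t : Fin N) :
    orderSign ![x, y, z, t] = orderSign ![x, y] * (orderSign ![x, z] * orderSign ![y, z]) *
      (orderSign ![x, t] * orderSign ![y, t] * orderSign ![z, t]) := by
  simp [orderSign, Int.sign_mul, Fin.prod_univ_succ]
  ring

theorem placeBracket_vec (p : ℕ → R) (x y z t : Fin N) :
    placeBracket p ![x, y, z, t] = (orderSign ![x, y, z, t] : R) *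
      p (2 ^ (x : ℕ) + 2 ^ (y : ℕ) + 2 ^ (z : ℕ) + 2 ^ (t : ℕ)) := by
  simp [placeBracket, placeCode, Fin.sum_univ_four]

theorem orderSign_mul_self {x y : Fin N} (h : x ≠ y) :
    orderSign ![x, y] * orderSign ![x, y] = 1 := by
  have hxy : (y : ℤ) - x ≠ 0 := sub_ne_zero.mpr fun h' => h (Fin.ext (Int.ofNat_inj.mp h').symm)
  rw [orderSign, ← Int.sign_mul, Int.sign_eq_one_iff_pos]
  simpa [Fin.prod_univ_succ] using hxy

theorem IsPlucker.three_term (hp : IsPlucker 4 N p) {a b c d i j : Fin N} (hab : a < b)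
    (hbc : b < c) (hcd : c < d) (hi : i ∉ [a, b, c, d]) (hj : j ∉ [a, b, c, d]) (hij : i ≠ j) :
    p (placeCode ![i, j, a, c]) * p (placeCode ![i, j, b, d]) =
      p (placeCode ![i, j, a, b]) * p (placeCode ![i, j, c, d]) +
        p (placeCode ![i, j, a, d]) * p (placeCode ![i, j, b, c]) := by
  let E (x : Fin N) : ℤ := orderSign ![i, x] * orderSign ![j, x]
  have hE {x : Fin N} (hx : x ∈ [a, b, c, d]) : IsUnit (E x) :=
    .mul (.of_mul_eq_one _ (orderSign_mul_self fun h => hi (h ▸ hx)))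
      (.of_mul_eq_one _ (orderSign_mul_self fun h => hj (h ▸ hx)))
  have hsign : IsUnit (E a * E b * E c * E d) :=
    (((hE (by simp)).mul (hE (by simp))).mul (hE (by simp))).mul (hE (by simp))
  have hsq := congrArg (Int.cast : ℤ → R) (orderSign_mul_self hij)
  have hi0 : orderSign ![i, j, a, i] = 0 := orderSign_eq_zero (a := 0) (b := 3) (by decide) rfl
  have hj0 : orderSign ![i, j, a, j] = 0 := orderSign_eq_zero (a := 1) (b := 3) (by decide) rfl
  have hexchange := hp.exchange_vec i j a c i j b d
  simp only [placeBracket, hi0, hj0, orderSign_vec, orderSign_pair a, orderSign_pair b,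
    orderSign_pair c, hab, hbc, hcd, hab.trans hbc, hbc.trans hcd, (hab.trans hbc).trans hcd,
    if_true] at hexchange
  refine (hsign.map (Int.castRingHom R)).mul_left_cancel ?_
  simp only [eq_intCast, E]
  push_cast at hexchange hsq ⊢
  linear_combination hexchange - (orderSign ![i, a] * orderSign ![j, a] *
    (orderSign ![i, b] * orderSign ![j, b]) * (orderSign ![i, c] * orderSign ![j, c]) *
    (orderSign ![i, d] * orderSign ![j, d]) : R) * (p (placeCode ![i, j, a, c]) *
    p (placeCode ![i, j, b, d]) - p (placeCode ![i, j, a, b]) * p (placeCode ![i, j, c, d]) -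
    p (placeCode ![i, j, a, d]) * p (placeCode ![i, j, b, c])) * hsq

end FourRows

section Relations

/-- A coordinate, or a difference of products of two coordinates, of a vector that is indexed by
numbers. -/
inductive PlaceAtom
  | coord (m : ℕ)
  | diff (a b c d : ℕ)
  deriving DecidableEq

instance (m : ℕ) : OfNat PlaceAtom m :=
  ⟨.coord m⟩

/-- A relation `divisor * target = terms`, where `terms` is a sum of products. -/
structure PlaceRelation where
  divisor : PlaceAtom
  target : PlaceAtom
  terms : List (List PlaceAtom)

namespace PlaceAtom

/-- The value of an atom at the vector `p`. -/
def value {R : Type*} [CommRing R] (p : ℕ → R) : PlaceAtom → R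
  | coord m => p m
  | diff a b c d => p a * p b - p c * p d

/-- The atom after a renumbering `g` of the places. -/
def map (g : ℕ → ℕ) : PlaceAtom → PlaceAtom
  | coord m => coord (g m)
  | diff a b c d => diff (g a) (g b) (g c) (g d)

/-- The atom with the factors of its products in increasing order. -/
def normalize : PlaceAtom → PlaceAtom
  | coord m => coord m
  | diff a b c d => diff (min a b) (max a b) (min c d) (max c d)

end PlaceAtom

namespace PlaceRelation

/-- The vector `p` satisfies the relation. -/
def Holds {R : Type*} [CommRing R] (p : ℕ → R) (r : PlaceRelation) : Prop :=
  r.divisor.value p * r.target.value p =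
    (r.terms.map fun t => (t.map (PlaceAtom.value p)).prod).sum

/-- The same relation, for division by the other factor on the left hand side. -/
def swap (r : PlaceRelation) : PlaceRelation :=
  ⟨r.target, r.divisor, r.terms⟩

/-- The relation after a renumbering `g` of the places. -/
def map (g : ℕ → ℕ) (r : PlaceRelation) : PlaceRelation :=
  ⟨r.divisor.map g, r.target.map g, r.terms.map (List.map (PlaceAtom.map g))⟩

end PlaceRelation

/-- The binary code of a set of four places, given by its decimal digits. -/
def quad (m : ℕ) : ℕ :=
  2 ^ (m / 1000) + 2 ^ (m / 100 % 10) + 2 ^ (m / 10 % 10) + 2 ^ (m % 10)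

/-- Relations between Plücker coordinates and their products, in terms of decimal digits. -/
def coordRelations : List PlaceRelation := [
  ⟨0135, 2367, [[0123, 3567], [.diff 0136 2357 0137 2356]]⟩,
  ⟨1357, 0246, [[0345, 1267], [1235, 0467], [1247, 0356], [2357, 0146], [3456, 0127]]⟩,
  ⟨0125, 0347, [[0127, 0345], [.diff 0125 0347 0127 0345]]⟩,
  ⟨0124, 1357, [[0123, 1457], [.diff 0124 1357 0123 1457]]⟩]

/-- Relations that determine a difference of products of Plücker coordinates, in terms of decimal
digits. -/
def diffRelations : List PlaceRelation := [
  ⟨0156, .diff 1236 1457 1237 1456, [[0167, 1235, 1456], [1567, .diff 0145 1236 0123 1456]]⟩,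
  ⟨0125, .diff 0145 1236 0123 1456, [[0123, 0156, 1245], [0126, 0145, 1235]]⟩,
  ⟨0134, .diff 0147 2367 0167 2347, [[0123, 0147, 3467], [0137, .diff 0146 2347 0147 2346]]⟩,
  ⟨0124, .diff 0146 0235 0156 0234, [[0123, 0146, 0245], [0126, 0145, 0234]]⟩,
  ⟨0124, .diff 0145 1236 0123 1456, [[0123, 0146, 1245], [0126, 0145, 1234]]⟩,
  ⟨0146, .diff 1236 1457 1237 1456, [[0167, 1234, 1456], [1467, .diff 0145 1236 0123 1456]]⟩,
  ⟨0124, .diff 0147 2367 0167 2347, [[0123, 0147, 2467], [0127, .diff 0146 2347 0147 2346]]⟩,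
  ⟨0236, .diff 0125 2467 0124 2567, [[0123, 0267, 2456], [0126, .diff 0236 2457 0237 2456]]⟩,
  ⟨0135, .diff 0146 0235 0156 0234, [[0123, 0156, 0345], [0136, 0145, 0235]]⟩,
  ⟨0137, .diff 0246 1237 0123 2467, [[0127, .diff 0347 1236 0367 1234],
    [0237, .diff 0147 1236 0167 1234]]⟩,
  ⟨0135, .diff 0345 1236 0123 3456, [[0123, 0356, 1345], [0136, 0345, 1235]]⟩,
  ⟨0134, .diff 0357 1236 0367 1235, [[0123, .diff 0356 1347 0134 3567], [0137, 0356, 1234]]⟩,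
  ⟨0135, .diff 0145 1236 0123 1456, [[0123, 0156, 1345], [0136, 0145, 1235]]⟩,
  ⟨0124, .diff 0136 2467 0126 3467, [[0123, 0146, 2467], [0126, .diff 0146 2347 0147 2346]]⟩]

section Holds

variable {R : Type*} [CommRing R] {p : ℕ → R}

theorem PlaceAtom.value_map (g : ℕ → ℕ) (x : PlaceAtom) :
    (x.map g).value p = x.value fun m => p (g m) := by
  cases x <;> rfl

theorem PlaceAtom.value_normalize (x : PlaceAtom) : x.normalize.value p = x.value p := by
  have hmul (a b : ℕ) : p (min a b) * p (max a b) = p a * p b := by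
    rcases le_total a b with h | h
    · rw [min_eq_left h, max_eq_right h]
    · rw [min_eq_right h, max_eq_left h, mul_comm]
  cases x with
  | coord m => rfl
  | diff a b c d => exact congrArg₂ (· - ·) (hmul a b) (hmul c d)

theorem PlaceRelation.holds_map_iff {g : ℕ → ℕ} {r : PlaceRelation} :
    (r.map g).Holds p ↔ r.Holds fun m => p (g m) := by
  simp only [PlaceRelation.Holds, PlaceRelation.map, PlaceAtom.value_map, List.map_map,
    Function.comp_def]

theorem PlaceRelation.Holds.swap {r : PlaceRelation} (h : r.Holds p) : r.swap.Holds p :=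
  (mul_comm _ _).trans h

theorem IsPlucker.holds_coordRelations (hp : IsPlucker 4 8 p) :
    ∀ r ∈ coordRelations, r.Holds fun m => p (quad m) := by
  simp only [coordRelations, List.forall_mem_cons, PlaceRelation.Holds,
    PlaceAtom.value, List.map, List.prod_cons, List.prod_nil, List.sum_cons,
    List.sum_nil, mul_one, add_zero]
  refine ⟨?_, ?_, by ring, by ring, List.forall_mem_nil _⟩
  on_goal 1 =>
    linear_combination (norm := skip) hp.exchange_vec 0 1 3 2 3 5 6 7
  on_goal 2 =>
    linear_combination (norm := skip) hp.exchange_vec 1 4 6 0 2 3 5 7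
      + hp.exchange_vec 0 3 5 1 2 4 6 7 + hp.exchange_vec 1 3 5 0 2 4 6 7
      - hp.exchange_vec 0 2 7 1 3 4 5 6
  all_goals
    simp [placeBracket_vec, orderSign_vec, orderSign_pair, quad]
    ring

theorem IsPlucker.holds_diffRelations (hp : IsPlucker 4 8 p) :
    ∀ r ∈ diffRelations, r.Holds fun m => p (quad m) := by
  simp only [diffRelations, List.forall_mem_cons, PlaceRelation.Holds,
    PlaceAtom.value, List.map, List.prod_cons, List.prod_nil, List.sum_cons,
    List.sum_nil, mul_one, add_zero]
  refine ⟨?_, ?_, ?_, ?_, ?_, ?_, ?_, ?_, ?_, ?_, ?_, ?_, ?_, ?_, List.forall_mem_nil _⟩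
  on_goal 1 =>
    linear_combination (norm := skip) -p (quad 1456) * hp.exchange_vec 1 2 3 0 1 5 6 7
      + p (quad 1236) * hp.exchange_vec 1 4 5 0 1 5 6 7
  on_goal 2 =>
    linear_combination (norm := skip) p (quad 0123) * hp.exchange_vec 1 2 5 0 1 4 5 6
      + p (quad 0145) * hp.exchange_vec 1 2 3 0 1 2 5 6
  on_goal 3 =>
    linear_combination (norm := skip) p (quad 0147) * hp.exchange_vec 0 1 3 2 3 4 6 7
      + p (quad 2347) * hp.exchange_vec 0 1 4 3 0 1 6 7
  on_goal 4 =>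
    linear_combination (norm := skip) -p (quad 0146) * hp.exchange_vec 0 2 3 1 0 2 4 5
      + p (quad 0234) * hp.exchange_vec 0 1 4 2 0 1 5 6
  on_goal 5 =>
    linear_combination (norm := skip) p (quad 0123) * hp.exchange_vec 1 2 4 0 1 4 5 6
      + p (quad 0145) * hp.exchange_vec 1 2 3 0 1 2 4 6
  on_goal 6 =>
    linear_combination (norm := skip) -p (quad 1456) * hp.exchange_vec 1 2 3 0 1 4 6 7
      + p (quad 1236) * hp.exchange_vec 1 4 5 0 1 4 6 7
  on_goal 7 =>
    linear_combination (norm := skip) -p (quad 0147) * hp.exchange_vec 0 1 2 3 2 4 6 7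
      + p (quad 2347) * hp.exchange_vec 0 1 4 2 0 1 6 7
  on_goal 8 =>
    linear_combination (norm := skip) -p (quad 0236) * hp.exchange_vec 0 1 2 4 2 5 6 7
      - p (quad 2456) * hp.exchange_vec 0 2 3 1 0 2 6 7
  on_goal 9 =>
    linear_combination (norm := skip) -p (quad 0156) * hp.exchange_vec 0 2 3 1 0 3 4 5
      + p (quad 0235) * hp.exchange_vec 0 1 4 3 0 1 5 6
  on_goal 10 =>
    linear_combination (norm := skip) p (quad 0137) * hp.exchange_vec 1 2 3 0 2 4 6 7
      - p (quad 1236) * hp.exchange_vec 0 2 7 1 0 3 4 7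
      + p (quad 1234) * hp.exchange_vec 0 2 7 1 0 3 6 7
  on_goal 11 =>
    linear_combination (norm := skip) p (quad 0123) * hp.exchange_vec 1 3 5 0 3 4 5 6
      + p (quad 0345) * hp.exchange_vec 1 2 3 0 1 3 5 6
  on_goal 12 =>
    linear_combination (norm := skip) -p (quad 0134) * hp.exchange_vec 1 2 3 0 3 5 6 7
      + p (quad 0356) * hp.exchange_vec 1 2 3 0 1 3 4 7
  on_goal 13 =>
    linear_combination (norm := skip) p (quad 0123) * hp.exchange_vec 1 3 5 0 1 4 5 6
      + p (quad 0145) * hp.exchange_vec 1 2 3 0 1 3 5 6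
  on_goal 14 =>
    linear_combination (norm := skip) p (quad 0126) * hp.exchange_vec 0 1 4 2 3 4 6 7
      + p (quad 2467) * hp.exchange_vec 0 1 3 2 0 1 4 6
  all_goals
    simp [placeBracket_vec, orderSign_vec, orderSign_pair, quad]
    ring

end Holds

end Relations

section Force

/-- `f k`, written so that the kernel computes `k` before it unfolds `f`. -/
def force {α : Type*} (k : ℕ) (f : ℕ → α) : α :=
  Nat.rec (f 0) (fun m _ => f (Nat.succ m)) k

theorem force_eq {α : Type*} (k : ℕ) (f : ℕ → α) : force k f = f k := by
  cases k <;> rfl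

end Force

section Lanes

/-- A rule for sets of places, given by their binary codes: if the place `divisor` belongs to a set
of divisors and all places in `need` belong to a set, then `target` may be added to the latter. -/
structure LaneRule where
  divisor : ℕ
  target : ℕ
  need : List ℕ

/-- All places in the rule are below `W`, and the rule respects `G` as a property of the places in
a set, if `A` is a property of the divisors. -/
def LaneRule.IsSound (W : ℕ) (A G : ℕ → Prop) (r : LaneRule) : Prop :=
  r.divisor < W ∧ r.target < W ∧ (∀ i ∈ r.need, i < W) ∧
    (A r.divisor → (∀ i ∈ r.need, G i) → G r.target)

/-- The number whose lanes, which are its blocks of `W` binary digits, are the sets in `l`. -/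
def pack (W : ℕ) (l : List ℕ) : ℕ :=
  List.rec 0 (fun c _ ih => Nat.add (Nat.mul (Nat.pow 2 W) ih) (Nat.mod c (Nat.pow 2 W))) l

/-- The positions `i` in `m` such that all places in `need`, counted from `i`, belong to `S`. -/
def selectShifts (S m : ℕ) (need : List ℕ) : ℕ :=
  List.rec m (fun i _ ih => Nat.land (Nat.shiftRight S i) ih) need

/-- Apply a rule in all lanes of `S` at once. The binary digits of `ones` mark the lowest places of
the lanes, and the lanes of `C` are the sets of divisors. -/
def applyRule (ones C : ℕ) (r : LaneRule) (S : ℕ) : ℕ :=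
  Nat.lor S (Nat.shiftLeft
    (selectShifts S (Nat.land (Nat.shiftRight C r.divisor) ones) r.need) r.target)

/-- Apply the rules in a list one after the other. -/
noncomputable def applyRules (ones C : ℕ) (t : List LaneRule) : ℕ → ℕ :=
  List.rec (motive := fun _ => ℕ → ℕ) (fun S => S)
    (fun r _ ih S => force (applyRule ones C r S) ih) t

/-- Apply the rules in a list `k` times. -/
noncomputable def iterateRules (ones C : ℕ) (t : List LaneRule) (k : ℕ) : ℕ → ℕ :=
  Nat.rec (motive := fun _ => ℕ → ℕ) (fun S => S)
    (fun _ ih S => force (applyRules ones C t S) ih) k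

/-- The elements of `l` for which the corresponding lane of `S`, from position `o` on, does not
contain `full`. -/
noncomputable def remaining (W full S : ℕ) (l : List ℕ) : ℕ → List ℕ :=
  List.rec (motive := fun _ => ℕ → List ℕ) (fun _ => [])
    (fun c _ ih o => Bool.rec (c :: force (Nat.add o W) ih) (force (Nat.add o W) ih)
      (Nat.beq (Nat.land (Nat.shiftRight S o) full) full)) l

/-- The sets of divisors in `l` from which `k` rounds of the rules do not lead to all places in
`full`.

The kernel hashes a number by its lowest digits. Lane `0` is not used for a set: it holds a number
that depends on the list, so that the numbers for different lists have different hashes. -/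
noncomputable def unresolved (W full : ℕ) (t : List LaneRule) (k : ℕ) (l : List ℕ) : List ℕ :=
  force (pack W (0 :: l.map fun _ => 1)) fun ones => force (pack W l) fun C =>
    force (pack W (Nat.mul (Nat.mod C 72057594037927931) 256 :: l)) fun C =>
      force (iterateRules ones C t k C) fun S => remaining W full S l W

/-- The concatenation of the lists `f l'`, for the segments `l'` of `l` of length `k`. -/
noncomputable def bySegments (k : ℕ) (f : List ℕ → List ℕ) (fuel : ℕ) : List ℕ → List ℕ :=
  Nat.rec (motive := fun _ => List ℕ → List ℕ) f
    (fun _ ih l => List.rec [] (fun _ _ _ => f (l.take k) ++ ih (l.drop k)) l) fuel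

/-- All places in lane `k` of `S` have the property `G`. -/
def LaneSatisfies (W k S : ℕ) (G : ℕ → Prop) : Prop :=
  ∀ i < W, S.testBit (W * k + i) → G i

variable {W : ℕ} {A G : ℕ → Prop}

theorem testBit_selectShifts {S m i : ℕ} {need : List ℕ}
    (h : (selectShifts S m need).testBit i) : m.testBit i ∧ ∀ j ∈ need, S.testBit (i + j) := by
  induction need with
  | nil => exact ⟨h, fun _ hj => absurd hj List.not_mem_nil⟩
  | cons a l ih =>
    change ((S >>> a) &&& selectShifts S m l).testBit i = true at h
    rw [Nat.testBit_and, Bool.and_eq_true, Nat.testBit_shiftRight, add_comm] at h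
    exact ⟨(ih h.2).1, List.forall_mem_cons.mpr ⟨h.1, (ih h.2).2⟩⟩

theorem LaneRule.IsSound.applyRule {k ones C S : ℕ} {r : LaneRule} (hr : r.IsSound W A G)
    (hones : ∀ i, ones.testBit i → W ∣ i) (hC : LaneSatisfies W k C A)
    (hS : LaneSatisfies W k S G) : LaneSatisfies W k (applyRule ones C r S) G := by
  intro i hi h
  change (S ||| (selectShifts S ((C >>> r.divisor) &&& ones) r.need) <<< r.target).testBit _ = true
    at h
  rw [Nat.testBit_or, Bool.or_eq_true, Nat.testBit_shiftLeft, Bool.and_eq_true,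
    decide_eq_true_iff] at h
  obtain h | ⟨htarget, hselect⟩ := h
  · exact hS i hi h
  obtain ⟨hstart, hneed⟩ := testBit_selectShifts hselect
  rw [Nat.testBit_and, Bool.and_eq_true, Nat.testBit_shiftRight, add_comm] at hstart
  obtain ⟨q, hq⟩ := hones _ hstart.2
  have hW : 0 < W := (Nat.zero_le i).trans_lt hi
  have hlane : W * q + r.target = W * k + i := by rw [← hq, Nat.sub_add_cancel htarget]
  have hqk : q = k := by
    simpa only [Nat.mul_add_div hW, Nat.div_eq_of_lt hr.2.1, Nat.div_eq_of_lt hi, add_zero]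
      using congrArg (· / W) hlane
  rw [hqk] at hq hlane
  rw [hq] at hstart hneed
  exact Nat.add_left_cancel hlane ▸ hr.2.2.2 (hC _ hr.1 hstart.1)
    fun j hj => hS j (hr.2.2.1 j hj) (hneed j hj)

theorem laneSatisfies_applyRules {k ones C S : ℕ} {t : List LaneRule}
    (ht : ∀ r ∈ t, r.IsSound W A G) (hones : ∀ i, ones.testBit i → W ∣ i)
    (hC : LaneSatisfies W k C A) (hS : LaneSatisfies W k S G) :
    LaneSatisfies W k (applyRules ones C t S) G := by
  induction t generalizing S with
  | nil => exact hS
  | cons r t ih =>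
    change LaneSatisfies W k (force (applyRule ones C r S) (applyRules ones C t)) G
    obtain ⟨hr, ht⟩ := List.forall_mem_cons.mp ht
    rw [force_eq]
    exact ih ht (hr.applyRule hones hC hS)

theorem laneSatisfies_iterateRules {k ones C S : ℕ} {t : List LaneRule} (m : ℕ)
    (ht : ∀ r ∈ t, r.IsSound W A G) (hones : ∀ i, ones.testBit i → W ∣ i)
    (hC : LaneSatisfies W k C A) (hS : LaneSatisfies W k S G) :
    LaneSatisfies W k (iterateRules ones C t m S) G := by
  induction m generalizing S with
  | zero => exact hS
  | succ m ih =>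
    change LaneSatisfies W k (force (applyRules ones C t S) (iterateRules ones C t m)) G
    rw [force_eq]
    exact ih (laneSatisfies_applyRules ht hones hC hS)

theorem pack_cons (W c : ℕ) (l : List ℕ) : pack W (c :: l) = 2 ^ W * pack W l + c % 2 ^ W := rfl

theorem laneSatisfies_pack {k c : ℕ} {l : List ℕ} (hk : l[k]? = some c)
    (hc : ∀ i, c.testBit i → A i) : LaneSatisfies W k (pack W l) A := by
  induction l generalizing k with
  | nil => simp at hk
  | cons d l ih =>
    intro i hi h
    rw [pack_cons, Nat.testBit_two_pow_mul_add _ (Nat.mod_lt _ (Nat.two_pow_pos W))] at h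
    cases k with
    | zero =>
      obtain rfl : d = c := by simpa using hk
      rw [mul_zero, zero_add, if_pos hi, Nat.testBit_mod_two_pow, Bool.and_eq_true] at h
      exact hc i h.2
    | succ k =>
      rw [mul_add, mul_one, if_neg (by omega),
        show W * k + W + i - W = W * k + i by omega] at h
      exact ih (by simpa using hk) i hi h

theorem dvd_of_testBit_pack_ones (hW : W ≠ 0) (l : List ℕ) {i : ℕ}
    (h : (pack W (l.map fun _ => 1)).testBit i) : W ∣ i := by
  induction l generalizing i with
  | nil => simp [pack] at h
  | cons c l ih =>
    rw [List.map_cons, pack_cons, Nat.mod_eq_of_lt (Nat.one_lt_two_pow hW),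
      Nat.testBit_two_pow_mul_add _ (Nat.one_lt_two_pow hW)] at h
    split_ifs at h with hi
    · rw [Nat.testBit_one_eq_true_iff_self_eq_zero.mp h]
      exact dvd_zero W
    · exact (Nat.dvd_sub_iff_left (not_lt.mp hi) dvd_rfl).mp (ih h)

theorem mem_remaining {full k o c S : ℕ} {l : List ℕ} (hk : l[k]? = some c) :
    c ∈ remaining W full S l o ∨ ∀ i, full.testBit i → S.testBit (W * k + o + i) := by
  induction l generalizing k o with
  | nil => simp at hk
  | cons d l ih =>
    have hcons : remaining W full S (d :: l) o =
        Bool.rec (d :: remaining W full S l (o + W)) (remaining W full S l (o + W))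
          (Nat.beq ((S >>> o) &&& full) full) :=
      congrArg (fun l' => (Bool.rec (d :: l') l' (Nat.beq ((S >>> o) &&& full) full) : List ℕ))
        (force_eq (o + W) (remaining W full S l))
    rw [hcons]
    cases k with
    | zero =>
      obtain rfl : d = c := by simpa using hk
      cases hb : Nat.beq ((S >>> o) &&& full) full
      · exact Or.inl List.mem_cons_self
      · refine Or.inr fun i hi => ?_
        have h := congrArg (fun x => x.testBit i) (Nat.eq_of_beq_eq_true hb)
        simpa [hi] using h
    | succ k =>
      rw [mul_add, mul_one, show W * k + W + o = W * k + (o + W) by ring]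
      refine (ih (k := k) (o := o + W) (by simpa using hk)).imp_left fun h => ?_
      cases Nat.beq ((S >>> o) &&& full) full
      · exact List.mem_cons_of_mem _ h
      · exact h

theorem mem_unresolved {full m c : ℕ} {t : List LaneRule} {l : List ℕ} (hW : W ≠ 0)
    (hAG : ∀ i, A i → G i) (ht : ∀ r ∈ t, r.IsSound W A G) (hfull : full < 2 ^ W) (hc : c ∈ l)
    (hA : ∀ i, c.testBit i → A i) :
    c ∈ unresolved W full t m l ∨ ∀ i, full.testBit i → G i := by
  obtain ⟨k, hk⟩ := List.mem_iff_getElem?.mp hc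
  simp only [unresolved, force_eq]
  have hC (d : ℕ) : LaneSatisfies W (k + 1) (pack W (d :: l)) A :=
    laneSatisfies_pack (by simpa using hk) hA
  have hones {i : ℕ} (h : (pack W (0 :: l.map fun _ => 1)).testBit i) : W ∣ i := by
    rw [pack_cons, Nat.zero_mod, add_zero, Nat.testBit_two_pow_mul, Bool.and_eq_true,
      decide_eq_true_iff] at h
    exact (Nat.dvd_sub_iff_left h.1 dvd_rfl).mp (dvd_of_testBit_pack_ones hW l h.2)
  refine (mem_remaining hk).imp_right fun h i hi => ?_
  refine laneSatisfies_iterateRules m ht (fun i => hones) (hC _)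
    (fun i hi h => hAG i (hC _ i hi h)) i ?_ (h i hi)
  by_contra hiW
  rw [Nat.testBit_lt_two_pow (hfull.trans_le (Nat.pow_le_pow_right two_pos (not_lt.mp hiW)))] at hi
  exact Bool.false_ne_true hi

theorem mem_bySegments {k c : ℕ} {f : List ℕ → List ℕ} {Q : Prop}
    (hf : ∀ l, c ∈ l → c ∈ f l ∨ Q) (fuel : ℕ) (l : List ℕ) (hc : c ∈ l) :
    c ∈ bySegments k f fuel l ∨ Q := by
  induction fuel generalizing l with
  | zero => exact hf l hc
  | succ fuel ih =>
    cases l with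
    | nil => exact absurd hc List.not_mem_nil
    | cons d l =>
      change c ∈ f ((d :: l).take k) ++ bySegments k f fuel ((d :: l).drop k) ∨ Q
      rw [← List.take_append_drop k (d :: l), List.mem_append] at hc
      rw [List.mem_append]
      exact hc.elim (fun hc => (hf _ hc).imp_left Or.inl) fun hc => (ih _ hc).imp_left Or.inr

end Lanes

section Rules

/-- The action of the rotation `x ↦ x + 1` of the octagon on binary codes of sets of vertices. -/
def rotateCode (m : ℕ) : ℕ :=
  2 * m % 256 + m / 128

/-- The action of the reflection `x ↦ 7 - x` of the octagon on binary codes of sets of vertices. -/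
def reverseCode (m : ℕ) : ℕ :=
  ((List.range 8).map fun i => m / 2 ^ i % 2 * 2 ^ (7 - i)).sum

/-- The symmetries of the octagon, as functions on binary codes of sets of vertices. -/
def octagonSymmetries : List (ℕ → ℕ) :=
  (List.range 8).flatMap fun k => [rotateCode^[k], rotateCode^[k] ∘ reverseCode]

/-- The three-term Plücker relation for `a < b < c < d` and two further places. -/
def threeTermRelation (i j a b c d : Fin 8) : PlaceRelation :=
  let coord (x y : Fin 8) : PlaceAtom :=
    .coord (2 ^ (i : ℕ) + 2 ^ (j : ℕ) + 2 ^ (x : ℕ) + 2 ^ (y : ℕ))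
  ⟨coord a c, coord b d, [[coord a b, coord c d], [coord a d, coord b c]]⟩

/-- All three-term Plücker relations for eight places, for division by either of the two factors. -/
def threeTermRelations : List PlaceRelation :=
  let places := List.finRange 8
  let relations := places.flatMap fun d => (places.filter (· < d)).flatMap fun c =>
    (places.filter (· < c)).flatMap fun b => (places.filter (· < b)).flatMap fun a =>
      let others := places.filter (· ∉ [a, b, c, d])
      others.flatMap fun i => (others.filter (· < i)).map fun j => threeTermRelation i j a b c d
  relations ++ relations.map PlaceRelation.swap

/-- The images of `coordRelations` and `diffRelations` under the symmetries of the octagon, the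
former in both directions. -/
def octagonRelations : List PlaceRelation :=
  let relations := coordRelations ++ coordRelations.map PlaceRelation.swap ++ diffRelations
  relations.flatMap fun r => octagonSymmetries.map fun g => (r.map quad).map g

/-- The differences of products that occur in `octagonRelations`. -/
def differenceTable : List PlaceAtom :=
  [.diff 39 89 71 57, .diff 51 201 195 57, .diff 39 201 15 225, .diff 83 45 99 29,
    .diff 85 58 83 60].flatMap fun x : PlaceAtom =>
      octagonSymmetries.map fun g => (x.map g).normalize

/-- The set of four vertices of the octagon whose code has the same remainder modulo `128` as `i`,
if there is one. -/
def liftCode (i : ℕ) : ℕ :=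
  if ((List.range 7).filter i.testBit).length = 4 then i else i + 128

/-- The coordinate or difference of products at place `i` of a lane. A set of four vertices is
determined by its intersection with `{0, …, 6}`, so the coordinates fit into `128` places. -/
def laneAtom (i : ℕ) : PlaceAtom :=
  if i < 128 then .coord (liftCode i) else differenceTable.getD (i - 128) (.coord 0)

/-- The place of an atom in a lane: `laneAtom` takes it back to the atom, up to the order of the
factors. -/
def PlaceAtom.lane : PlaceAtom → ℕ
  | .coord m => m % 128
  | .diff a b c d => 128 + differenceTable.idxOf (PlaceAtom.diff a b c d).normalize

/-- The rule that the relation gives for a semiring: it contains `target` if it contains all of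
`terms` and `divisor` is a unit of it. -/
def PlaceRelation.laneRule (r : PlaceRelation) : LaneRule :=
  ⟨r.divisor.lane, r.target.lane, r.terms.flatten.map PlaceAtom.lane⟩

/-- All coordinates and differences of products in `r` have places in lanes of width `W`. -/
def PlaceRelation.FitsLane (W : ℕ) (r : PlaceRelation) : Prop :=
  ∀ x ∈ r.divisor :: r.target :: r.terms.flatten, x.lane < W ∧ laneAtom x.lane = x.normalize

instance (W : ℕ) : DecidablePred (PlaceRelation.FitsLane W) := fun _ =>
  inferInstanceAs (Decidable (∀ _ ∈ _, _))

theorem fitsLane_threeTermRelations : ∀ r ∈ threeTermRelations, r.FitsLane 208 := by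
  decide +kernel

theorem fitsLane_octagonRelations : ∀ r ∈ octagonRelations, r.FitsLane 208 := by
  decide +kernel

variable {R : Type*} [CommRing R] {p : ℕ → R}

theorem IsPlucker.rotate (hp : IsPlucker 4 8 p) : IsPlucker 4 8 fun m => p (rotateCode m) := by
  have h : ∀ i j k l : Fin 8, i < j ∧ j < k ∧ k < l →
      rotateCode (placeCode ![i, j, k, l]) = placeCode ((· + 1) ∘ ![i, j, k, l]) ∧
        (∏ a, if ![i, j, k, l] a = 7 then -1 else 1) * orderSign ((· + 1) ∘ ![i, j, k, l]) = 1 := by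
    decide +kernel
  have hs (s : Fin 4 → Fin 8) (hs : StrictMono s) :=
    h (s 0) (s 1) (s 2) (s 3) ⟨hs (by decide), hs (by decide), hs (by decide)⟩
  have hvec (s : Fin 4 → Fin 8) : ![s 0, s 1, s 2, s 3] = s := List.ofFn_injective rfl
  simp only [hvec] at hs
  exact hp.relabel _ (fun x => if x = 7 then -1 else 1) (fun s h => (hs s h).1)
    fun s h => (hs s h).2

theorem IsPlucker.reverse (hp : IsPlucker 4 8 p) : IsPlucker 4 8 fun m => p (reverseCode m) := by
  have h : ∀ i j k l : Fin 8, i < j ∧ j < k ∧ k < l →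
      reverseCode (placeCode ![i, j, k, l]) = placeCode (Fin.rev ∘ ![i, j, k, l]) ∧
        orderSign (Fin.rev ∘ ![i, j, k, l]) = 1 := by
    decide +kernel
  have hs (s : Fin 4 → Fin 8) (hs : StrictMono s) :=
    h (s 0) (s 1) (s 2) (s 3) ⟨hs (by decide), hs (by decide), hs (by decide)⟩
  have hvec (s : Fin 4 → Fin 8) : ![s 0, s 1, s 2, s 3] = s := List.ofFn_injective rfl
  simp only [hvec] at hs
  refine hp.relabel Fin.rev 1 (fun s h => (hs s h).1) fun s h => ?_
  simpa using (hs s h).2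

theorem IsPlucker.comp_symmetry (hp : IsPlucker 4 8 p) {g : ℕ → ℕ} (hg : g ∈ octagonSymmetries) :
    IsPlucker 4 8 fun m => p (g m) := by
  have hrotate (k : ℕ) : IsPlucker 4 8 fun m => p (rotateCode^[k] m) := by
    induction k with
    | zero => exact hp
    | succ k ih => exact ih.rotate
  simp only [octagonSymmetries, List.mem_flatMap, List.mem_cons, List.not_mem_nil, or_false] at hg
  obtain ⟨k, -, rfl | rfl⟩ := hg
  · exact hrotate k
  · exact (hrotate k).reverse

theorem IsPlucker.holds_octagonRelations (hp : IsPlucker 4 8 p) :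
    ∀ r ∈ octagonRelations, r.Holds p := by
  simp only [octagonRelations, List.mem_flatMap, List.mem_append, List.mem_map]
  rintro _ ⟨r, hr, g, hg, rfl⟩
  have hpg := hp.comp_symmetry hg
  rw [PlaceRelation.holds_map_iff, PlaceRelation.holds_map_iff]
  obtain (hr | ⟨r, hr, rfl⟩) | hr := hr
  · exact hpg.holds_coordRelations r hr
  · exact (hpg.holds_coordRelations r hr).swap
  · exact hpg.holds_diffRelations r hr

theorem IsPlucker.holds_threeTermRelations (hp : IsPlucker 4 8 p) :
    ∀ r ∈ threeTermRelations, r.Holds p := by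
  have h : ∀ a b c d i j : Fin 8, a < b → b < c → c < d → i ∉ [a, b, c, d] → j ∉ [a, b, c, d] →
      j < i → (threeTermRelation i j a b c d).Holds p := by
    intro a b c d i j hab hbc hcd hi hj hij
    simpa [PlaceRelation.Holds, threeTermRelation, PlaceAtom.value, placeCode, Fin.sum_univ_four]
      using hp.three_term hab hbc hcd hi hj hij.ne'
  simp only [threeTermRelations, List.mem_append, List.mem_map, List.mem_flatMap, List.mem_filter,
    decide_eq_true_iff]
  rintro _ (⟨d, -, c, ⟨-, hcd⟩, b, ⟨-, hbc⟩, a, ⟨-, hab⟩, i, ⟨-, hi⟩, j, ⟨⟨-, hj⟩, hij⟩, rfl⟩ |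
    ⟨_, ⟨d, -, c, ⟨-, hcd⟩, b, ⟨-, hbc⟩, a, ⟨-, hab⟩, i, ⟨-, hi⟩, j, ⟨⟨-, hj⟩, hij⟩, rfl⟩, rfl⟩)
  · exact h a b c d i j hab hbc hcd hi hj hij
  · exact (h a b c d i j hab hbc hcd hi hj hij).swap

theorem PlaceRelation.FitsLane.isSound {W : ℕ} {r : PlaceRelation} (hr : r.FitsLane W)
    (hp : r.Holds p) (S : Subsemiring R) :
    r.laneRule.IsSound W (fun i => IsUnitOf S ((laneAtom i).value p))
      fun i => (laneAtom i).value p ∈ S := by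
  have hvalue {x : PlaceAtom} (hx : laneAtom x.lane = x.normalize) :
      (laneAtom x.lane).value p = x.value p := by
    rw [hx, PlaceAtom.value_normalize]
  obtain ⟨hdivisor, htarget, hterms⟩ :=
    (List.forall_mem_cons.trans (and_congr_right' List.forall_mem_cons)).mp hr
  refine ⟨hdivisor.1, htarget.1, List.forall_mem_map.mpr fun x hx => (hterms x hx).1,
    fun hunit hneed => ?_⟩
  simp only [laneRule, List.mem_map, forall_exists_index, and_imp, forall_apply_eq_imp_iff₂,
    hvalue hdivisor.2, hvalue htarget.2] at hunit hneed ⊢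
  refine hunit.mem_of_mul_mem (hp ▸ S.list_sum_mem ?_)
  refine List.forall_mem_map.mpr fun t ht => S.list_prod_mem ?_
  refine List.forall_mem_map.mpr fun x hx => ?_
  have hx : x ∈ r.terms.flatten := List.mem_flatten.mpr ⟨t, ht, hx⟩
  exact hvalue (hterms x hx).2 ▸ hneed x hx

end Rules

section Codes

instance (n : ℕ) : Fintype (MinorIndex n) :=
  Fintype.ofEquiv {p : Finset (Fin n) × Finset (Fin n) // p.1.card = p.2.card}
    { toFun := fun p => ⟨p.1.1, p.1.2, p.2⟩
      invFun := fun D => ⟨(D.rows, D.cols), D.card_eq⟩ }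

/-- The binary code of the set of places that belongs to a minor of a `4 × 4` matrix. -/
def MinorIndex.code (D : MinorIndex 4) : ℕ :=
  ∑ x ∈ D.places, 2 ^ (x : ℕ)

theorem MinorIndex.liftCode_code : ∀ D : MinorIndex 4, liftCode (D.code % 128) = D.code := by
  decide +kernel

theorem maximalMinor_signedExtension {R : Type*} [CommRing R] (M : Matrix (Fin 4) (Fin 4) R)
    (D : MinorIndex 4) : maximalMinor (signedExtension M) D.code = M.minorAt D :=
  (maximalMinor_sum_two_pow _ _).trans (finsetMinor_signedExtension M D)

/-- The number whose binary digits `1` are at the places `f i`, for `i` in `s`. -/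
def bits {ι : Type*} (s : Finset ι) (f : ι → ℕ) : ℕ :=
  s.fold (· ||| ·) 0 fun i => 1 <<< f i

theorem testBit_bits {ι : Type*} {s : Finset ι} {f : ι → ℕ} {k : ℕ} :
    (bits s f).testBit k ↔ ∃ i ∈ s, f i = k := by
  classical
  induction s using Finset.induction_on with
  | empty => simp [bits]
  | insert a s ha ih =>
    rw [bits, Finset.fold_insert ha, ← bits, Nat.testBit_or, Bool.or_eq_true, ih,
      Nat.one_shiftLeft, Nat.testBit_two_pow, decide_eq_true_iff, Finset.exists_mem_insert]

end Codes

namespace StringColor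

/-- The summand by which a label contributes to the code of a chamber label. At the left end, the
strings of each colour are ordered from bottom to top by increasing weight. -/
def labelWeight {n : ℕ} (c : StringColor) (i : Fin n) : ℕ :=
  match c with
  | red => 2 ^ (3 - i : ℕ)
  | blue => 2 ^ (i : ℕ)

theorem sum_labelWeight_le {n : ℕ} (hn : n ≤ 4) (c : StringColor) (s : Finset (Fin n)) :
    ∑ i ∈ s, c.labelWeight i ≤ 15 := by
  refine (Finset.sum_le_univ_sum_of_nonneg fun _ => Nat.zero_le _).trans ?_
  interval_cases n <;> cases c <;> decide

/-- The code of the chamber above a crossing of colour `c` after the passage of the crossing, when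
`a`, `b`, `d` are the codes of the chambers below, at and above the crossing before its passage. -/
def crossedCode (c : StringColor) (a b d : ℕ) : ℕ :=
  match c with
  | red => (a / 16 + d / 16 - b / 16) * 16 + b % 16
  | blue => b / 16 * 16 + (a % 16 + d % 16 - b % 16)

/-- The strings of a crossing of colour `c` have met before, if the crossing changes the code of the
chamber between them from `b` to `m`. -/
def isIllegal (c : StringColor) (b m : ℕ) : Bool :=
  match c with
  | red => decide (b ≤ m)
  | blue => decide (m ≤ b)

/-- The crossings of colour `c` between chambers of codes `a`, `b` and `d`, from bottom to top, are
illegal. -/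
def isStuckAt (c : StringColor) (a b d : ℕ) : Bool :=
  c.isIllegal b (c.crossedCode a b d)

end StringColor

theorem MinorIndex.code_eq : ∀ D : MinorIndex 4,
    D.code = 16 * (15 - ∑ i ∈ D.rows, StringColor.red.labelWeight i) +
      ∑ j ∈ D.cols, StringColor.blue.labelWeight j := by
  decide +kernel

namespace StringCrossing

variable {n : ℕ}

/-- The total weight of the labels of the lowest `k` strings of colour `c`. -/
def weightBelow (s : Orders n) (c : StringColor) (k : ℕ) : ℕ :=
  ∑ a ∈ below (s c) k, c.labelWeight a

theorem weightBelow_succ (s : Orders n) (c : StringColor) (p : Fin n) :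
    weightBelow s c (p + 1) = weightBelow s c p + c.labelWeight (s c p) := by
  have hinsert : below (s c) (p + 1) = insert (s c p) (below (s c) p) := by
    ext a
    rw [Finset.mem_insert, mem_below, mem_below, ← Equiv.symm_apply_eq, Fin.ext_iff]
    omega
  rw [weightBelow, hinsert, Finset.sum_insert (by simp [mem_below]), add_comm]
  rfl

theorem weightBelow_mono (s : Orders n) (c : StringColor) : Monotone (weightBelow s c) :=
  fun _ _ h => Finset.sum_le_sum_of_subset fun _ ha => mem_below.mpr ((mem_below.mp ha).trans_le h)

theorem weightBelow_of_le (s : Orders n) (c : StringColor) {k l : ℕ} (hk : n ≤ k) (hkl : k ≤ l) :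
    weightBelow s c l = weightBelow s c k := by
  refine congrArg (Finset.sum · _) (Finset.ext fun a => ?_)
  rw [mem_below, mem_below]
  omega

theorem weightBelow_cross_of_ne (s : Orders n) (x : StringCrossing n) {c : StringColor} {k : ℕ}
    (h : c ≠ x.color ∨ k ≠ x.level.val + 1) : weightBelow (cross s x) c k = weightBelow s c k := by
  rcases h with h | h
  · rw [weightBelow, cross, if_neg h.symm, weightBelow]
  · rw [weightBelow, below_cross s x c h, weightBelow]

theorem weightBelow_cross (s : Orders n) (x : StringCrossing n) :
    weightBelow (cross s x) x.color (x.level + 1) + weightBelow s x.color (x.level + 1) =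
      weightBelow s x.color x.level + weightBelow s x.color (x.level + 2) := by
  have hlevel : weightBelow (cross s x) x.color x.level = weightBelow s x.color x.level :=
    weightBelow_cross_of_ne s x (Or.inr (Nat.ne_of_lt (Nat.lt_succ_self _)))
  have happly : cross s x x.color x.lowerPos = s x.color x.upperPos := by
    rw [cross, if_pos rfl, Equiv.Perm.mul_apply, Equiv.swap_apply_left]
  have hlower : weightBelow (cross s x) x.color (x.level + 1) = _ :=
    weightBelow_succ (cross s x) x.color x.lowerPos
  have hupper : weightBelow s x.color (x.level + 2) = _ := weightBelow_succ s x.color x.upperPos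
  rw [happly] at hlower
  simp only [lowerPos, upperPos] at hlower hupper
  omega

theorem runsBelow_nil_iff (hn : n ≤ 4) (c : StringColor) (a b : Fin n) :
    RunsBelow (ordersAfter []) c a b ↔ c.labelWeight a < c.labelWeight b := by
  cases c with
  | red =>
    change Fin.rev a < Fin.rev b ↔ 2 ^ (3 - a : ℕ) < 2 ^ (3 - b : ℕ)
    rw [Fin.rev_lt_rev, Nat.pow_lt_pow_iff_right one_lt_two, Fin.lt_def]
    omega
  | blue =>
    change a < b ↔ 2 ^ (a : ℕ) < 2 ^ (b : ℕ)
    rw [Nat.pow_lt_pow_iff_right one_lt_two, Fin.lt_def]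

theorem isLegal_iff (hn : n ≤ 4) (s : Orders n) (x : StringCrossing n) :
    IsLegal s x ↔ 2 * weightBelow s x.color (x.level + 1) <
      weightBelow s x.color x.level + weightBelow s x.color (x.level + 2) := by
  have hlower := weightBelow_succ s x.color x.lowerPos
  have hupper := weightBelow_succ s x.color x.upperPos
  change weightBelow s x.color (x.level + 1) = weightBelow s x.color x.level + _ at hlower
  change weightBelow s x.color (x.level + 2) = weightBelow s x.color (x.level + 1) + _ at hupper
  rw [IsLegal, runsBelow_nil_iff hn]
  omega

/-- The code of the label of the chamber above `k` strings of each colour. -/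
def codeAt (hn : n ≤ 4) (s : Orders n) (k : ℕ) : ℕ :=
  ((chamberAt s k).castLE hn).code

theorem weightBelow_le (hn : n ≤ 4) (s : Orders n) (c : StringColor) (k : ℕ) :
    weightBelow s c k ≤ 15 :=
  c.sum_labelWeight_le hn _

variable (hn : n ≤ 4) (s : Orders n)

theorem codeAt_eq (k : ℕ) :
    codeAt hn s k = 16 * (15 - weightBelow s .red k) + weightBelow s .blue k := by
  rw [codeAt, MinorIndex.code_eq]
  simp only [MinorIndex.castLE, Finset.sum_map]
  rfl

theorem isIllegal_crossedCode_iff (c : StringColor) (k : ℕ) :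
    c.isIllegal (codeAt hn s (k + 1))
        (c.crossedCode (codeAt hn s k) (codeAt hn s (k + 1)) (codeAt hn s (k + 2))) = true ↔
      weightBelow s c k + weightBelow s c (k + 2) ≤ 2 * weightBelow s c (k + 1) := by
  have hle := weightBelow_le hn s
  have hmono₁ := weightBelow_mono s c (Nat.le_add_right k 1)
  have hmono₂ := weightBelow_mono s c (Nat.le_add_right (k + 1) 1)
  have := hle .red k
  have := hle .red (k + 1)
  have := hle .red (k + 2)
  have := hle .blue k
  have := hle .blue (k + 1)
  have := hle .blue (k + 2)
  cases c <;> simp only [StringColor.isIllegal, StringColor.crossedCode, decide_eq_true_iff,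
    codeAt_eq] <;> omega

theorem isIllegal_crossedCode_eq_false {x : StringCrossing n} (hx : IsLegal s x) :
    x.color.isIllegal (codeAt hn s (x.level + 1)) (x.color.crossedCode (codeAt hn s x.level)
      (codeAt hn s (x.level + 1)) (codeAt hn s (x.level + 2))) = false := by
  rw [← Bool.not_eq_true, isIllegal_crossedCode_iff, not_le]
  exact (isLegal_iff hn s x).mp hx

theorem isIllegal_crossedCode_of_forall_not_isLegal (h : ∀ x, ¬ IsLegal s x) (c : StringColor)
    (k : ℕ) :
    c.isIllegal (codeAt hn s (k + 1))
      (c.crossedCode (codeAt hn s k) (codeAt hn s (k + 1)) (codeAt hn s (k + 2))) = true := by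
  rw [isIllegal_crossedCode_iff]
  by_cases hk : k < n - 1
  · exact not_lt.mp (mt (isLegal_iff hn s ⟨c, k, hk⟩).mpr (h _))
  · have := weightBelow_of_le s c (k := k + 1) (l := k + 2) (by omega) (by omega)
    have := weightBelow_mono s c (Nat.le_add_right k 1)
    omega

theorem codeAt_cross (x : StringCrossing n) :
    codeAt hn (cross s x) (x.level + 1) = x.color.crossedCode (codeAt hn s x.level)
      (codeAt hn s (x.level + 1)) (codeAt hn s (x.level + 2)) := by
  obtain ⟨c, l⟩ := x
  have hcross := weightBelow_cross s ⟨c, l⟩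
  have hother := fun c' h => weightBelow_cross_of_ne s ⟨c, l⟩ (c := c') (k := l + 1) (Or.inl h)
  have hmono₁ := weightBelow_mono s c (Nat.le_add_right (l : ℕ) 1)
  have hmono₂ := weightBelow_mono s c (Nat.le_add_right (l + 1 : ℕ) 1)
  have hred := weightBelow_le hn s .red
  have hblue := weightBelow_le hn s .blue
  have := hred l
  have := hred (l + 1)
  have := hred (l + 2)
  have := hblue l
  have := hblue (l + 1)
  have := hblue (l + 2)
  cases c with
  | red =>
    have := hother .blue (by simp)
    simp only [StringColor.crossedCode, codeAt_eq] at *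
    omega
  | blue =>
    have := hother .red (by simp)
    simp only [StringColor.crossedCode, codeAt_eq] at *
    omega

theorem codeAt_cross_of_ne (x : StringCrossing n) {k : ℕ} (hk : k ≠ x.level + 1) :
    codeAt hn (cross s x) k = codeAt hn s k := by
  rw [codeAt, chamberAt_cross s x hk, codeAt]

end StringCrossing

namespace StringCrossing

/-- No crossing is legal on a vertical line that meets chambers of the codes `h₀, …, h₄`. -/
def isStuck (h₀ h₁ h₂ h₃ h₄ : ℕ) : Bool :=
  [StringColor.red, StringColor.blue].all fun c =>
    c.isStuckAt h₀ h₁ h₂ && c.isStuckAt h₁ h₂ h₃ && c.isStuckAt h₂ h₃ h₄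

/-- The results of the crossing of colour `c` at level `l`, if it is legal and in order, followed by
the members of `acc`. The chambers below, at and above the crossing have the codes `a`, `b`, `d`;
the code of the new chamber is added to the set `C` of the codes modulo `128` of all chambers so
far, and `next` continues with it. -/
def move (c : StringColor) (ok l a b d C : ℕ) (next : ℕ → ℕ → List ℕ → List ℕ)
    (acc : List ℕ) : List ℕ :=
  if ok ≤ l then
    force (c.crossedCode a b d) fun m =>
      if c.isIllegal b m then acc else force (C ||| 1 <<< (m % 128)) fun C' => next m C' acc
  else acc

/-- The sets of codes modulo `128` of the chambers that are met by the complete words in normal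
form, followed by the members of `acc`. The words start on a vertical line with chambers of the
codes `h₀, …, h₄`; `okr` and `okb` are the lowest levels at which their first crossing is in order
if it is red, respectively blue, and `C` is the set of codes met before. A word that is too long for
`fuel` gives the empty set, which has no chance to pass the later tests. -/
def search (h₀ h₄ : ℕ) : (fuel okr okb h₁ h₂ h₃ C : ℕ) → List ℕ → List ℕ
  | 0, _, _, _, _, _, _, acc => 0 :: acc
  | fuel + 1, okr, okb, h₁, h₂, h₃, C, acc =>
      if isStuck h₀ h₁ h₂ h₃ h₄ then C :: acc else
        move .red okr 0 h₀ h₁ h₂ C (fun m => search h₀ h₄ fuel 0 0 m h₂ h₃) <|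
        move .red okr 1 h₁ h₂ h₃ C (fun m => search h₀ h₄ fuel 0 1 h₁ m h₃) <|
        move .red okr 2 h₂ h₃ h₄ C (fun m => search h₀ h₄ fuel 1 2 h₁ h₂ m) <|
        move .blue okb 0 h₀ h₁ h₂ C (fun m => search h₀ h₄ fuel 0 0 m h₂ h₃) <|
        move .blue okb 1 h₁ h₂ h₃ C (fun m => search h₀ h₄ fuel 1 0 h₁ m h₃) <|
        move .blue okb 2 h₂ h₃ h₄ C (fun m => search h₀ h₄ fuel 2 1 h₁ h₂ m) acc

theorem mem_move_of_mem {c : StringColor} {ok l a b d C e : ℕ} {next : ℕ → ℕ → List ℕ → List ℕ}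
    {acc : List ℕ} (hnext : ∀ m C' acc, e ∈ acc → e ∈ next m C' acc) (he : e ∈ acc) :
    e ∈ move c ok l a b d C next acc := by
  simp only [move, force_eq]
  split_ifs
  · exact he
  · exact hnext _ _ _ he
  · exact he

theorem mem_move {c : StringColor} {ok l a b d C e : ℕ} {next : ℕ → ℕ → List ℕ → List ℕ}
    {acc : List ℕ} (hok : ok ≤ l) (hlegal : c.isIllegal b (c.crossedCode a b d) = false)
    (he : e ∈ next (c.crossedCode a b d) (C ||| 1 <<< (c.crossedCode a b d % 128)) acc) :
    e ∈ move c ok l a b d C next acc := by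
  rwa [move, if_pos hok, force_eq, hlegal, if_neg Bool.false_ne_true, force_eq]

theorem mem_search_of_mem {h₀ h₄ fuel okr okb h₁ h₂ h₃ C e : ℕ} {acc : List ℕ} (he : e ∈ acc) :
    e ∈ search h₀ h₄ fuel okr okb h₁ h₂ h₃ C acc := by
  induction fuel generalizing okr okb h₁ h₂ h₃ C acc with
  | zero => exact List.mem_cons_of_mem _ he
  | succ fuel ih =>
    rw [search]
    split_ifs
    · exact List.mem_cons_of_mem _ he
    · iterate 6 refine mem_move_of_mem (fun _ _ _ => ih) ?_
      exact he

variable {n : ℕ} (hn : n ≤ 4) (s : Orders n)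

/-- The search that starts on a vertical line where the orders of the strings are `s`, from the
lowest levels `ok` at which the first crossing is in order. -/
def searchFrom (fuel : ℕ) (ok : StringColor → ℕ) (C : ℕ) (acc : List ℕ) : List ℕ :=
  search (codeAt hn s 0) (codeAt hn s 4) fuel (ok .red) (ok .blue) (codeAt hn s 1) (codeAt hn s 2)
    (codeAt hn s 3) C acc

/-- The lowest level at which a crossing of colour `c` is in order after the crossing `x`. -/
def nextOk (x : StringCrossing n) (c : StringColor) : ℕ :=
  if x.color = c then x.level - 1 else x.level

theorem nextOk_le_iff (x y : StringCrossing n) : nextOk x y.color ≤ y.level ↔ InOrder x y := by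
  unfold nextOk InOrder
  by_cases h : x.color = y.color
  · simp only [h, if_true, true_and]
    omega
  · simp only [h, if_false, false_and, or_false]

theorem isStuck_codeAt_iff :
    isStuck (codeAt hn s 0) (codeAt hn s 1) (codeAt hn s 2) (codeAt hn s 3) (codeAt hn s 4) ↔
      ∀ x, ¬ IsLegal s x := by
  refine ⟨fun h x hx => ?_, fun h => ?_⟩
  · have hlegal := isIllegal_crossedCode_eq_false hn s hx
    obtain ⟨c, ⟨l, hl⟩⟩ := x
    simp only [isStuck, List.all_cons, List.all_nil, Bool.and_true, Bool.and_eq_true,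
      StringColor.isStuckAt] at h
    obtain rfl | rfl | rfl : l = 0 ∨ l = 1 ∨ l = 2 := by omega
    all_goals cases c <;> simp_all
  · have hstuck := isIllegal_crossedCode_of_forall_not_isLegal hn s h
    simp only [isStuck, List.all_cons, List.all_nil, Bool.and_true, Bool.and_eq_true,
      StringColor.isStuckAt]
    exact ⟨⟨⟨hstuck _ 0, hstuck _ 1⟩, hstuck _ 2⟩, ⟨hstuck _ 0, hstuck _ 1⟩, hstuck _ 2⟩

theorem mem_searchFrom_succ {fuel C e : ℕ} {ok : StringColor → ℕ} {x : StringCrossing n}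
    (hx : IsLegal s x) (hok : ok x.color ≤ x.level)
    (h : ∀ acc, e ∈ searchFrom hn (cross s x) fuel (nextOk x)
      (C ||| 1 <<< (codeAt hn (cross s x) (x.level + 1) % 128)) acc) (acc : List ℕ) :
    e ∈ searchFrom hn s (fuel + 1) ok C acc := by
  have hlegal := isIllegal_crossedCode_eq_false hn s hx
  have hcross := codeAt_cross hn s x
  have hother := fun k => codeAt_cross_of_ne hn s x (k := k)
  rw [searchFrom, search, if_neg (mt (isStuck_codeAt_iff hn s).mp (not_forall_not.mpr ⟨x, hx⟩))]
  obtain ⟨c, ⟨l, hl⟩⟩ := x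
  have hl' : l = 0 ∨ l = 1 ∨ l = 2 := by omega
  rcases hl' with rfl | rfl | rfl <;> cases c <;>
    simp only [searchFrom, nextOk, hcross, hother, ne_eq, zero_add, Nat.reduceAdd, Nat.reduceSub,
      Nat.reduceEqDiff, OfNat.zero_ne_ofNat, OfNat.one_ne_ofNat, OfNat.ofNat_ne_one, zero_ne_one,
      not_false_eq_true, reduceCtorEq, reduceIte] at h <;>
    repeat' first
      | exact mem_move hok hlegal (h _)
      | refine mem_move_of_mem (fun _ _ _ => mem_search_of_mem) ?_

theorem exists_mem_searchFrom (fuel : ℕ) {w : List (StringCrossing n)} (hw : IsComplete s w)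
    (hchain : w.IsChain InOrder) {ok : StringColor → ℕ}
    (hok : ∀ x ∈ w.head?, ok x.color ≤ x.level) (C : ℕ) :
    ∃ e, (∀ acc, e ∈ searchFrom hn s fuel ok C acc) ∧
      ∀ i, e.testBit i → C.testBit i ∨ ∃ D ∈ chambers s w, i = (D.castLE hn).code % 128 := by
  induction fuel generalizing s w ok C with
  | zero => exact ⟨0, fun acc => List.mem_cons_self, by simp⟩
  | succ fuel ih =>
    cases w with
    | nil =>
      refine ⟨C, fun acc => ?_, fun i hi => Or.inl hi⟩
      rw [searchFrom, search, if_pos ((isStuck_codeAt_iff hn s).mpr hw)]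
      exact List.mem_cons_self
    | cons x w =>
      obtain ⟨hhead, htail⟩ := List.isChain_cons.mp hchain
      obtain ⟨e, he, hbits⟩ := ih (cross s x) hw.2 htail (ok := nextOk x)
        (fun y hy => (nextOk_le_iff x y).mpr (hhead y hy))
        (C ||| 1 <<< (codeAt hn (cross s x) (x.level + 1) % 128))
      refine ⟨e, mem_searchFrom_succ hn s hw.1 (hok x rfl) he, fun i hi => ?_⟩
      rcases hbits i hi with hC | ⟨D, hD, hi⟩
      · rw [Nat.testBit_or, Nat.one_shiftLeft, Nat.testBit_two_pow, Bool.or_eq_true,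
          decide_eq_true_iff] at hC
        exact hC.imp_right fun hi => ⟨chamberAt (cross s x) (x.level + 1),
          Or.inr (chambersAt_subset_chambers _ w ⟨_, rfl⟩), hi.symm⟩
      · exact Or.inr ⟨D, Or.inr hD, hi⟩

end StringCrossing

section ChamberSets

open StringCrossing

variable {n : ℕ} (hn : n ≤ 4)

/-- The sets of codes modulo `128` of the chambers of the diagrams in normal form. -/
def chamberSets : List ℕ :=
  force (codeAt hn (ordersAfter []) 0) fun h₀ => force (codeAt hn (ordersAfter []) 1) fun h₁ =>
    force (codeAt hn (ordersAfter []) 2) fun h₂ => force (codeAt hn (ordersAfter []) 3) fun h₃ =>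
      force (codeAt hn (ordersAfter []) 4) fun h₄ =>
        force (bits (Finset.range 5) fun k => codeAt hn (ordersAfter []) k % 128) fun C =>
          search h₀ h₄ 13 0 0 h₁ h₂ h₃ C []

theorem chamberSets_eq_searchFrom :
    chamberSets hn = searchFrom hn (ordersAfter []) 13 (fun _ => 0)
      (bits (Finset.range 5) fun k => codeAt hn (ordersAfter []) k % 128) [] := by
  simp only [chamberSets, force_eq, searchFrom]

theorem DoubleWiringDiagram.exists_mem_chamberSets (w : DoubleWiringDiagram n) :
    ∃ c ∈ chamberSets hn, ∀ i, c.testBit i →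
      ∃ D ∈ w.chamberLabels ∪ {D | D.rows = ∅}, i = (D.castLE hn).code % 128 := by
  obtain ⟨v, hcomplete, hchain, hsub⟩ := w.exists_isComplete_isChain
  obtain ⟨c, hc, hbits⟩ := exists_mem_searchFrom hn _ 13 hcomplete hchain (ok := fun _ => 0)
    (fun _ _ => Nat.zero_le _)
    (bits (Finset.range 5) fun k => codeAt hn (ordersAfter []) k % 128)
  refine ⟨c, chamberSets_eq_searchFrom hn ▸ hc [], fun i hi => ?_⟩
  rcases hbits i hi with hi | ⟨D, hD, hi⟩
  · obtain ⟨k, -, rfl⟩ := testBit_bits.mp hi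
    exact ⟨_, hsub (chambersAt_subset_chambers _ v ⟨k, rfl⟩), rfl⟩
  · exact ⟨D, hsub hD, hi⟩

/-- The set of the codes modulo `128` of all minors of an `n × n` matrix. -/
def minorCodes : ℕ := bits Finset.univ fun D : MinorIndex n => (D.castLE hn).code % 128

theorem minorCodes_lt : minorCodes hn < 2 ^ 128 := by
  refine Nat.lt_pow_two_of_testBit _ fun i hi => ?_
  rw [← Bool.not_eq_true, minorCodes, testBit_bits]
  rintro ⟨D, -, rfl⟩
  exact (Nat.mod_lt _ (by norm_num)).not_ge hi

/-- The members of `sets` from which the relations do not lead to all minors of an `n × n`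
matrix. -/
noncomputable def exceptionalSets (sets : List ℕ) : List ℕ :=
  force (minorCodes hn) fun full =>
    bySegments 256
      (unresolved 208 full ((threeTermRelations ++ octagonRelations).map PlaceRelation.laneRule) 4)
      12 sets

set_option maxHeartbeats 1000000 in
-- The kernel needs less memory if it treats the two halves of the list one after the other.
theorem exceptionalSets_eq_nil : exceptionalSets hn ((chamberSets hn).take 2500) = [] ∧
    exceptionalSets hn ((chamberSets hn).drop 2500) = [] := by
  constructor <;> interval_cases n <;> decide +kernel +revert

end ChamberSets

section Minors

variable {n : ℕ} {R : Type*} [CommRing R] {S : Subsemiring R}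

theorem value_laneAtom_code (hn : n ≤ 4) (M : Matrix (Fin n) (Fin n) R) (D : MinorIndex n) :
    (laneAtom ((D.castLE hn).code % 128)).value
      (maximalMinor (signedExtension (zeroPadding 4 M))) = M.minorAt D := by
  rw [laneAtom, if_pos (Nat.mod_lt _ (by norm_num)), MinorIndex.liftCode_code]
  exact (maximalMinor_signedExtension _ _).trans (minorAt_zeroPadding hn M D)

theorem mem_exceptionalSets (hn : n ≤ 4) {p : ℕ → R} (hp : IsPlucker 4 8 p) {c : ℕ}
    {sets : List ℕ} (hc : c ∈ sets) (hunit : ∀ i, c.testBit i → IsUnitOf S ((laneAtom i).value p)) :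
    c ∈ exceptionalSets hn sets ∨
      ∀ i, (minorCodes hn).testBit i → (laneAtom i).value p ∈ S := by
  have hsound : ∀ r ∈ (threeTermRelations ++ octagonRelations).map PlaceRelation.laneRule,
      r.IsSound 208 (fun i => IsUnitOf S ((laneAtom i).value p))
        fun i => (laneAtom i).value p ∈ S :=
    List.forall_mem_map.mpr <| List.forall_mem_append.mpr
      ⟨fun r hr => (fitsLane_threeTermRelations r hr).isSound (hp.holds_threeTermRelations r hr) S,
        fun r hr => (fitsLane_octagonRelations r hr).isSound (hp.holds_octagonRelations r hr) S⟩
  have hfull : minorCodes hn < 2 ^ 208 :=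
    (minorCodes_lt hn).trans (Nat.pow_lt_pow_right one_lt_two (by norm_num))
  rw [exceptionalSets, force_eq]
  exact mem_bySegments
    (fun _ hc => mem_unresolved (by norm_num) (fun _ h => h.1) hsound hfull hc hunit) 12 _ hc

theorem isUnitOf_minorAt_of_rows_eq_empty (M : Matrix (Fin n) (Fin n) R) {D : MinorIndex n}
    (hD : D.rows = ∅) : IsUnitOf S (M.minorAt D) := by
  have : IsEmpty (Fin D.rows.card) := Finset.card_eq_zero.mpr hD ▸ Fin.isEmpty
  rw [Matrix.minorAt, Matrix.det_isEmpty]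
  exact isUnitOf_one

theorem DoubleWiringDiagram.minorAt_mem (hn : n ≤ 4) (w : DoubleWiringDiagram n)
    {M : Matrix (Fin n) (Fin n) R} (hM : ∀ D ∈ w.chamberLabels, IsUnitOf S (M.minorAt D))
    (D : MinorIndex n) : M.minorAt D ∈ S := by
  obtain ⟨c, hc, hbits⟩ := w.exists_mem_chamberSets hn
  have hp := isPlucker_maximalMinor (signedExtension (zeroPadding 4 M))
  have hunit (i : ℕ) (hi : c.testBit i) : IsUnitOf S ((laneAtom i).value
      (maximalMinor (signedExtension (zeroPadding 4 M)))) := by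
    obtain ⟨E, hE, rfl⟩ := hbits i hi
    rw [value_laneAtom_code]
    exact hE.elim (hM E) (isUnitOf_minorAt_of_rows_eq_empty M)
  rw [← List.take_append_drop 2500 (chamberSets hn), List.mem_append] at hc
  have hclosed := hc.elim (fun hc => (mem_exceptionalSets hn hp hc hunit).resolve_left
      ((exceptionalSets_eq_nil hn).1 ▸ List.not_mem_nil))
    fun hc => (mem_exceptionalSets hn hp hc hunit).resolve_left
      ((exceptionalSets_eq_nil hn).2 ▸ List.not_mem_nil)
  exact value_laneAtom_code hn M D ▸ hclosed _ (testBit_bits.mpr ⟨D, Finset.mem_univ D, rfl⟩)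

end Minors

section GenericMatrix

variable {n : ℕ}

/-- A matrix over a field such that the minors in `L` do not vanish. -/
structure NonvanishingPoint (L : Set (MinorIndex n)) : Type (u + 1) where
  K : Type u
  [field : Field K]
  matrix : Matrix (Fin n) (Fin n) K
  minorAt_ne_zero : ∀ D : L, matrix.minorAt D ≠ 0

attribute [instance] NonvanishingPoint.field

/-- The matrix over a product of fields that combines all matrices for which the minors in `L` do
not vanish. -/
def genericMatrix (L : Set (MinorIndex n)) :
    Matrix (Fin n) (Fin n) (∀ P : NonvanishingPoint.{u} L, P.K) :=
  Matrix.of fun i j P => P.matrix i j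

theorem minorAt_genericMatrix (L : Set (MinorIndex n)) (D : MinorIndex n)
    (P : NonvanishingPoint.{u} L) : (genericMatrix L).minorAt D P = P.matrix.minorAt D :=
  RingHom.map_det (Pi.evalRingHom (fun P : NonvanishingPoint L => P.K) P) _

/-- The values of Laurent polynomials in the minors in `L` of the generic matrix. -/
noncomputable def evalGeneric (L : Set (MinorIndex n)) :
    MvLaurent L →+* ∀ P : NonvanishingPoint.{u} L, P.K :=
  RingHom.pi fun P => MvLaurent.evalHom _ P.minorAt_ne_zero

theorem isUnitOf_minorAt_genericMatrix (L : Set (MinorIndex n)) (D : L) :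
    IsUnitOf ((MvLaurent.positiveSubsemiring L).map (evalGeneric.{u} L))
      ((genericMatrix L).minorAt D) := by
  have heval : evalGeneric L (AddMonoidAlgebra.single (Finsupp.single D 1) 1) =
      (genericMatrix L).minorAt D := by
    funext P
    refine ((MvLaurent.evalAt_single _ _).trans ?_).trans (minorAt_genericMatrix L D P).symm
    rw [Finsupp.prod_single_index (zpow_zero _), zpow_one]
  exact heval ▸ (MvLaurent.isUnitOf_single _).map _

end GenericMatrix

theorem mainTheorem3 (n : ℕ) (hn : n ≤ 4) (w : CommutationClass n) (D : MinorIndex n) :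
    ∃ f : MvLaurent w.chamberLabels, f.HasPositiveCoeffs ∧
      ∀ (K : Type*) [Field K] (M : Matrix (Fin n) (Fin n) K),
        (∀ C ∈ w.chamberLabels, M.minorAt C ≠ 0) →
          M.minorAt D = f.evalAt (fun C => M.minorAt C.1) := by
  refine Quotient.inductionOn w fun w => ?_
  have hmem := w.minorAt_mem hn
    (fun E hE => isUnitOf_minorAt_genericMatrix w.chamberLabels ⟨E, hE⟩) D
  obtain ⟨f, hf, heval⟩ := Subsemiring.mem_map.mp hmem
  refine ⟨f, hf, fun K _ M hM => ?_⟩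
  let P : NonvanishingPoint w.chamberLabels := ⟨K, M, fun E => hM E E.2⟩
  exact (minorAt_genericMatrix _ D P).symm.trans
    ((congrFun heval.symm P).trans (MvLaurent.evalHom_apply _ P.minorAt_ne_zero f))
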